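/- An inverse semigroup $S$ is a semigroup in which every $s$ has a unique $s^*$ with $ss^*s=s$ and $s^*ss^*=s^*$; all inverse semigroups here have a unit $1$. A partial action $\theta$ of $S$ on a $C^*$-algebra $A$ consists of closed two-sided ideals $A_s\subseteq A$ and $*$-isomorphisms $\theta_s:A_{s^*}\to A_s$ $(s\in S)$ such that $A_1=A$, $\theta_1=\mathrm{id}$, $\theta_{s^*}(A_s\cap A_{t^*})\subseteq A_{(ts)^*}$, and $\theta_{ts}$ extends $\theta_t\theta_s$ on $\theta_{s^*}(A_s\cap A_{t^*})$. A partial representation $v$ of $S$ on a Hilbert space $H$ is given by closed subspaces $H_s\subseteq H$ and surjective linear isometries $H_{s^*}\to H_s$ satisfying the same axioms; $v_s\in\mathcal B(H)$ is the partial isometry that is this isometry on $H_{s^*}$ and $0$ on $H_{s^*}^\perp$. A covariant representation of $(A,S,\theta)$ on $H$ is a pair $(\pi,v)$ of a $*$-homomorphism $\pi:A\to\mathcal B(H)$ and a partial representation $v$ of $S$ on $H$ such that, for all $s\in S$, the closed linear span of $\pi(A_s)H$ equals $v_sv_{s^*}H=H_s$, and $\pi(\theta_s(a))=v_s\pi(a)v_{s^*}$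 for all $a\in A_{s^*}$. Let $C_c(S,A)$ be the space of finite formal sums $\sum_s a_su_s$ with $a_s\in A_s$, with product and involution extending $$(au_s)(bu_t)=\theta_s(\theta_{s^*}(a)b)u_{st},\qquad (au_s)^*=\theta_{s^*}(a^*)u_{s^*}.$$ The crossed product $A\rtimes S$ is the $C^*$-algebra obtained as the Hausdorff completion of $C_c(S,A)$ for the seminorm $\|f\|=\sup\|(\pi\rtimes v)(f)\|$, where the supremum is over all covariant representations $(\pi,v)$ and $(\pi\rtimes v)(au_s)=\pi(a)v_s$. **Corollary.** Let $A$ and $B$ be $C^*$-algebras with partial actions $\theta$ and $\omega$ of a unital inverse semigroup $S$. Let $\varphi:A\to B$ be a completely positive map that is equivariant, i.e. $\varphi(A_s)\subseteq B_s$ and $\omega_s(\varphi(a))=\varphi(\theta_s(a))$ for all $s\in S$ and $a\in A_{s^*}$. Then the linear map $$C_c(S,A)\to C_c(S,B),\qquad au_s\mapsto\varphi(a)u_s,$$ extends to a completely positive map $\tilde\varphi:A\rtimes S\to B\rtimes S$. If $\varphi$ is contractive, then so is $\tilde\varphi$. -/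

import Mathlib

open scoped CStarAlgebra DirectSum

universe u v w

/-- An inverse semigroup with unit: a monoid in which every `s` has a unique `star s` with
`s * star s * s = s` and `star s * s * star s = star s`. -/
class InverseMonoid (S : Type v) extends Monoid S, Star S where
  mul_star_mul : ∀ s : S, s * star s * s = s
  star_mul_star : ∀ s : S, star s * s * star s = star s
  star_unique : ∀ s t : S, s * t * s = s → t * s * t = t → t = star s

namespace InverseMonoid

variable {S : Type v} [InverseMonoid S]

theorem starstar (s : S) : star (star s) = s :=
  (star_unique (star s) s (star_mul_star s) (mul_star_mul s)).symm

theorem star_idem {e : S} (he : e * e = e) : star e = e :=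
  (star_unique e e (by rw [he, he]) (by rw [he, he])).symm

theorem mul_idem {e f : S} (he : e * e = e) (hf : f * f = f) : e * f * (e * f) = e * f := by
  have h1 := mul_star_mul (e * f)
  have h2 := star_mul_star (e * f)
  set x := star (e * f) with hx
  have hy : f * x * e = x := by
    apply star_unique
    · calc e * f * (f * x * e) * (e * f) = e * (f * f) * x * (e * e) * f := by
            simp only [mul_assoc]
        _ = e * f * x * (e * f) := by rw [he, hf]; simp only [mul_assoc]
        _ = e * f := h1
    · calc f * x * e * (e * f) * (f * x * e) = f * x * (e * e) * (f * f) * x * e := by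
            simp only [mul_assoc]
        _ = f * (x * (e * f) * x) * e := by rw [he, hf]; simp only [mul_assoc]
        _ = f * x * e := by rw [h2]
  have hxx : x * x = x := by
    calc x * x = (f * x * e) * (f * x * e) := by rw [hy]
      _ = f * (x * (e * f) * x) * e := by simp only [mul_assoc]
      _ = x := by rw [h2, hy]
  have h3 : e * f = x := by
    have := starstar (e * f)
    rw [← hx, star_idem hxx] at this
    exact this.symm
  rw [h3, hxx]

theorem idem_comm {e f : S} (he : e * e = e) (hf : f * f = f) : e * f = f * e := by
  have h1 := mul_idem he hf
  have h2 := mul_idem hf he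
  have h3 : f * e = star (e * f) := by
    apply star_unique
    · calc e * f * (f * e) * (e * f) = e * (f * f) * (e * e) * f := by simp only [mul_assoc]
        _ = e * f * (e * f) := by rw [he, hf]; simp only [mul_assoc]
        _ = e * f := h1
    · calc f * e * (e * f) * (f * e) = f * (e * e) * (f * f) * e := by simp only [mul_assoc]
        _ = f * e * (f * e) := by rw [he, hf]; simp only [mul_assoc]
        _ = f * e := h2
  rw [h3, star_idem h1]

theorem star_mul_self_idem (s : S) : star s * s * (star s * s) = star s * s := by
  rw [← mul_assoc, star_mul_star]

theorem self_mul_star_idem (s : S) : s * star s * (s * star s) = s * star s := by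
  rw [← mul_assoc, mul_star_mul]

theorem star_mul_rev (s t : S) : star (s * t) = star t * star s := by
  have hc : t * star t * (star s * s) = star s * s * (t * star t) :=
    idem_comm (self_mul_star_idem t) (star_mul_self_idem s)
  refine (star_unique _ _ ?_ ?_).symm
  · calc s * t * (star t * star s) * (s * t) = s * (t * star t * (star s * s)) * t := by
          simp only [mul_assoc]
      _ = (s * star s * s) * (t * star t * t) := by rw [hc]; simp only [mul_assoc]
      _ = s * t := by rw [mul_star_mul, mul_star_mul]
  · calc star t * star s * (s * t) * (star t * star s)
          = star t * (star s * s * (t * star t)) * star s := by simp only [mul_assoc]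
      _ = (star t * t * star t) * (star s * s * star s) := by
          rw [← hc]; simp only [mul_assoc]
      _ = star t * star s := by rw [star_mul_star, star_mul_star]

end InverseMonoid

open InverseMonoid

/-- A partial action `θ` of a unital inverse semigroup on a C⋆-algebra `A`: closed two-sided
ideals `dom s` (closed two-sided ideals are automatically `⋆`-subalgebras, which is how they are
recorded here), and `⋆`-isomorphisms `act s : dom (star s) → dom s` with `dom 1 = A`, `act 1 = id`,
such that `act (t * s)` extends the composition `act t ∘ act s`, taken on its natural domain
`(act s)⁻¹ (dom s ∩ dom (star t))`. -/
structure PartialCStarAction (S : Type v) [InverseMonoid S] (A : Type u)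
    [NonUnitalCStarAlgebra A] where
  dom : S → NonUnitalStarSubalgebra ℂ A
  isClosed_dom : ∀ s, IsClosed (dom s : Set A)
  mul_mem_left : ∀ s (a b : A), b ∈ dom s → a * b ∈ dom s
  mul_mem_right : ∀ s (a b : A), a ∈ dom s → a * b ∈ dom s
  act : ∀ s, dom (star s) ≃⋆ₐ[ℂ] dom s
  dom_one : dom 1 = ⊤
  act_one : ∀ a : dom (star 1), (act 1 a : A) = a
  act_mul : ∀ s t (a : dom (star s)) (h : (act s a : A) ∈ dom (star t)),
    ∃ h' : (a : A) ∈ dom (star (t * s)), (act (t * s) ⟨a, h'⟩ : A) = act t ⟨act s a, h⟩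

namespace PartialCStarAction

variable {S : Type v} [InverseMonoid S] {A : Type u} [NonUnitalCStarAlgebra A]
  (α : PartialCStarAction S A)

theorem act_congr {s t : S} (h : s = t) (a : A) (h₁ : a ∈ α.dom (star s))
    (h₂ : a ∈ α.dom (star t)) : (α.act s ⟨a, h₁⟩ : A) = α.act t ⟨a, h₂⟩ := by
  subst h; rfl

theorem act_idem {e : S} (he : e * e = e) (a : α.dom (star e)) : (α.act e a : A) = a := by
  have hm : (α.act e a : A) ∈ α.dom (star e) := by
    have := (α.act e a).2
    have h2 : star e = e := star_idem he
    exact (congrArg (fun x => (α.act e a : A) ∈ α.dom x) h2).mpr this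
  obtain ⟨h', h⟩ := α.act_mul e e a hm
  rw [α.act_congr he _ h' a.2] at h
  have h2 : (a : α.dom (star e)) = ⟨α.act e a, hm⟩ := (α.act e).injective (Subtype.ext h)
  exact (congrArg Subtype.val h2).symm

/-- The map `θ_{s⋆} : A_s → A_{s⋆}`, on the domain `A_s = A_{s⋆⋆}`. -/
def actStar (s : S) (a : α.dom s) : α.dom (star s) :=
  α.act (star s) ⟨a, by rw [starstar]; exact a.2⟩

@[simp]
theorem actStar_act (s : S) (a : α.dom (star s)) : α.actStar s (α.act s a) = a := by
  have hm : (α.act s a : A) ∈ α.dom (star (star s)) := by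
    rw [starstar]; exact (α.act s a).2
  obtain ⟨h', h⟩ := α.act_mul s (star s) a hm
  rw [α.act_idem (star_mul_self_idem s)] at h
  exact Subtype.ext h.symm

@[simp]
theorem act_actStar (s : S) (a : α.dom s) : α.act s (α.actStar s a) = a := by
  obtain ⟨b, hb⟩ : ∃ b, α.act s b = a := (α.act s).surjective a
  rw [← hb, actStar_act]

theorem actStar_eq_symm (s : S) (a : α.dom s) : α.actStar s a = (α.act s).symm a := by
  obtain ⟨b, hb⟩ : ∃ b, α.act s b = a := (α.act s).surjective a
  rw [← hb, actStar_act]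
  simp

/-- `θ_s (A_{s⋆} ∩ A_t) ⊆ A_{st}`. -/
theorem act_mem (s t : S) (a : α.dom (star s)) (h : (a : A) ∈ α.dom t) :
    (α.act s a : A) ∈ α.dom (s * t) := by
  have hb : (α.act s a : A) ∈ α.dom (star (star s)) := by
    rw [starstar]; exact (α.act s a).2
  have hc : (α.act (star s) ⟨α.act s a, hb⟩ : A) ∈ α.dom (star (star t)) := by
    have := congrArg Subtype.val (α.actStar_act s a)
    simp only [actStar] at this
    rw [this, starstar]
    exact h
  obtain ⟨h', -⟩ := α.act_mul (star s) (star t) ⟨_, hb⟩ hc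
  rwa [← star_mul_rev, starstar] at h'

/-- A map `φ : A → B` is equivariant if it maps `A_s` into `B_s` and intertwines the actions. -/
structure IsEquivariant {B : Type w} [NonUnitalCStarAlgebra B] (α : PartialCStarAction S A)
    (β : PartialCStarAction S B) (φ : A → B) : Prop where
  mapsTo : ∀ s (a : A), a ∈ α.dom s → φ a ∈ β.dom s
  map_act : ∀ s (a : α.dom (star s)),
    (β.act s ⟨φ a, mapsTo (star s) a a.2⟩ : B) = φ (α.act s a)

/-- `C_c(S, A)`: finite formal sums `∑ a_s u_s` with `a_s ∈ A_s`. -/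
def Cc (α : PartialCStarAction S A) : Type (max u v) := ⨁ s, α.dom s

namespace Cc

noncomputable instance : AddCommGroup α.Cc := inferInstanceAs (AddCommGroup (⨁ s, α.dom s))
noncomputable instance : Module ℂ α.Cc := inferInstanceAs (Module ℂ (⨁ s, α.dom s))

open Classical in
/-- The element `a u_s`, for `a ∈ A_s`. -/
noncomputable def single (s : S) : α.dom s →ₗ[ℂ] α.Cc := DirectSum.lof ℂ S (fun s => α.dom s) s

open Classical in
/-- Linear extension of a map given on the elements `a u_s`. -/
noncomputable def lift {E : Type*} [AddCommGroup E] [Module ℂ E] (f : ∀ s, α.dom s →ₗ[ℂ] E) :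
    α.Cc →ₗ[ℂ] E := DirectSum.toModule ℂ S E f

variable {α}

@[simp]
theorem lift_single {E : Type*} [AddCommGroup E] [Module ℂ E] (f : ∀ s, α.dom s →ₗ[ℂ] E)
    (s : S) (a : α.dom s) : lift α f (single α s a) = f s a := by
  classical
  exact DirectSum.toModule_lof (M := fun s => α.dom s) ℂ s a

@[elab_as_elim]
theorem induction {p : α.Cc → Prop} (f : α.Cc) (zero : p 0)
    (single : ∀ s a, p (single α s a)) (add : ∀ f g, p f → p g → p (f + g)) : p f := by
  classical
  exact DirectSum.induction_on f zero (fun s a => single s a) add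

/-- `(a u_s) (b u_t) = θ_s(θ_{s⋆}(a) b) u_{st}` -/
noncomputable def mulSingle (s t : S) : α.dom s →ₗ[ℂ] α.dom t →ₗ[ℂ] α.dom (s * t) :=
  LinearMap.mk₂ ℂ
    (fun a b => ⟨α.act s ⟨α.actStar s a * b, α.mul_mem_right _ _ _ (α.actStar s a).2⟩,
      α.act_mem s t _ (α.mul_mem_left _ _ _ b.2)⟩)
    (fun a a' b => Subtype.ext <| by
      change ((α.act s _ : α.dom s) : A) = (α.act s _ : α.dom s) + (α.act s _ : α.dom s)
      rw [← NonUnitalStarSubalgebra.coe_add, ← map_add]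
      congr 2
      exact Subtype.ext (by simp [actStar_eq_symm, add_mul]))
    (fun c a b => Subtype.ext <| by
      change ((α.act s _ : α.dom s) : A) = c • ((α.act s _ : α.dom s) : A)
      rw [← NonUnitalStarSubalgebra.coe_smul, ← map_smul]
      congr 2
      exact Subtype.ext (by simp [actStar_eq_symm, smul_mul_assoc]))
    (fun a b b' => Subtype.ext <| by
      change ((α.act s _ : α.dom s) : A) = (α.act s _ : α.dom s) + (α.act s _ : α.dom s)
      rw [← NonUnitalStarSubalgebra.coe_add, ← map_add]
      congr 2
      exact Subtype.ext (by simp [mul_add]))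
    (fun c a b => Subtype.ext <| by
      change ((α.act s _ : α.dom s) : A) = c • ((α.act s _ : α.dom s) : A)
      rw [← NonUnitalStarSubalgebra.coe_smul, ← map_smul]
      congr 2
      exact Subtype.ext (by simp [mul_smul_comm]))

@[simp]
theorem coe_mulSingle (s t : S) (a : α.dom s) (b : α.dom t) :
    (mulSingle s t a b : A) =
      α.act s ⟨α.actStar s a * b, α.mul_mem_right _ _ _ (α.actStar s a).2⟩ := rfl

variable (α) in
/-- The product of `C_c(S, A)` as a bilinear map. -/
noncomputable def mulₗ : α.Cc →ₗ[ℂ] α.Cc →ₗ[ℂ] α.Cc :=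
  lift α fun s => (lift α fun t => ((mulSingle s t).compr₂ (single α (s * t))).flip).flip

noncomputable instance : Mul α.Cc := ⟨fun f g => mulₗ α f g⟩

theorem mul_def (f g : α.Cc) : f * g = mulₗ α f g := rfl

theorem single_mul_single (s t : S) (a : α.dom s) (b : α.dom t) :
    single α s a * single α t b = single α (s * t) (mulSingle s t a b) := by
  simp [mul_def, mulₗ]

/-- `(a u_s)⋆ = θ_{s⋆}(a⋆) u_{s⋆}`, extended additively. -/
noncomputable def starₐ : α.Cc →+ α.Cc := by
  classical
  exact DirectSum.toAddMonoid fun s =>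
    { toFun := fun a => single α (star s) (α.actStar s (star a))
      map_zero' := by simp [actStar_eq_symm]
      map_add' := fun a b => by simp [actStar_eq_symm] }

noncomputable instance : Star α.Cc := ⟨fun f => starₐ f⟩

theorem star_single (s : S) (a : α.dom s) :
    star (single α s a) = single α (star s) (α.actStar s (star a)) := by
  classical
  change starₐ (DirectSum.of (fun s => α.dom s) s a) = _
  exact DirectSum.toAddMonoid_of (β := fun s => α.dom s) _ s a

theorem star_add' (f g : α.Cc) : star (f + g) = star f + star g := map_add starₐ f g
theorem star_zero' : star (0 : α.Cc) = 0 := map_zero starₐ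

end Cc

end PartialCStarAction

/-- A partial representation of `S` on a Hilbert space `H`, i.e. a partial action of `S` on `H`:
closed subspaces `dom s` and surjective linear isometries `act s : dom (star s) → dom s` with
`dom 1 = H`, `act 1 = id`, such that `act (t * s)` extends the composition `act t ∘ act s`. -/
structure PartialRep (S : Type v) [InverseMonoid S] (H : Type w) [NormedAddCommGroup H]
    [InnerProductSpace ℂ H] where
  dom : S → Submodule ℂ H
  isClosed_dom : ∀ s, IsClosed (dom s : Set H)
  act : ∀ s, dom (star s) ≃ₗᵢ[ℂ] dom s
  dom_one : dom 1 = ⊤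
  act_one : ∀ x : dom (star 1), (act 1 x : H) = x
  act_mul : ∀ s t (x : dom (star s)) (h : (act s x : H) ∈ dom (star t)),
    ∃ h' : (x : H) ∈ dom (star (t * s)), (act (t * s) ⟨x, h'⟩ : H) = act t ⟨act s x, h⟩

namespace PartialRep

variable {S : Type v} [InverseMonoid S] {H : Type w} [NormedAddCommGroup H]
  [InnerProductSpace ℂ H] [CompleteSpace H] (V : PartialRep S H)

instance (s : S) : (V.dom s).HasOrthogonalProjection :=
  haveI := (V.isClosed_dom s).completeSpace_coe
  inferInstance

/-- The partial isometry `v_s ∈ B(H)`: it is `act s` on `dom (star s)` and zero on its orthogonal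
complement. Its final space is `v_s v_{s⋆} H = dom s`. -/
noncomputable def op (s : S) : H →L[ℂ] H :=
  (V.dom s).subtypeL ∘L ((V.act s).toContinuousLinearEquiv : V.dom (star s) →L[ℂ] V.dom s) ∘L
    (V.dom (star s)).orthogonalProjectionOnto

theorem op_apply (s : S) (x : H) :
    V.op s x = V.act s ((V.dom (star s)).orthogonalProjectionOnto x) := rfl

theorem op_apply_of_mem (s : S) (x : H) (hx : x ∈ V.dom (star s)) :
    V.op s x = V.act s ⟨x, hx⟩ := by
  rw [op_apply]
  congr 2
  exact Submodule.orthogonalProjectionOnto_mem_subspace_eq_self ⟨x, hx⟩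

theorem op_mem (s : S) (x : H) : V.op s x ∈ V.dom s := (V.act s _).2

theorem op_mul_apply (s t : S) (x : H) (hx : x ∈ V.dom (star s))
    (h : V.op s x ∈ V.dom (star t)) : V.op (t * s) x = V.op t (V.op s x) := by
  rw [V.op_apply_of_mem s x hx] at h ⊢
  obtain ⟨h', e⟩ := V.act_mul s t ⟨x, hx⟩ h
  rw [V.op_apply_of_mem _ _ h, V.op_apply_of_mem _ _ h', e]

theorem op_idem {e : S} (he : e * e = e) (x : H) (hx : x ∈ V.dom e) : V.op e x = x := by
  have hs : V.dom (star e) = V.dom e := congrArg V.dom (star_idem he)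
  have hx' : x ∈ V.dom (star e) := hs ▸ hx
  have hm : V.op e x ∈ V.dom (star e) := hs ▸ V.op_mem e x
  have h := V.op_mul_apply e e x hx' hm
  rw [he] at h
  rw [V.op_apply_of_mem _ _ hm] at h
  nth_rw 1 [V.op_apply_of_mem _ _ hx'] at h
  have := congrArg Subtype.val ((V.act e).injective (Subtype.ext h))
  exact this.symm

theorem op_star_op (s : S) (x : H) (hx : x ∈ V.dom (star s)) : V.op (star s) (V.op s x) = x := by
  have hm : V.op s x ∈ V.dom (star (star s)) := by rw [starstar]; exact V.op_mem s x
  rw [← V.op_mul_apply s (star s) x hx hm]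
  apply V.op_idem (star_mul_self_idem s)
  rw [V.op_apply_of_mem s x hx] at hm
  obtain ⟨h', -⟩ := V.act_mul s (star s) ⟨x, hx⟩ hm
  rwa [star_idem (star_mul_self_idem s)] at h'

theorem op_op_star (s : S) (x : H) (hx : x ∈ V.dom s) : V.op s (V.op (star s) x) = x := by
  have := V.op_star_op (star s) x (by rwa [starstar])
  rwa [starstar] at this

theorem norm_op_le (s : S) : ‖V.op s‖ ≤ 1 := by
  refine ContinuousLinearMap.opNorm_le_bound _ zero_le_one fun x => ?_
  rw [op_apply, one_mul, ← Submodule.coe_norm, LinearIsometryEquiv.norm_map]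
  exact Submodule.norm_orthogonalProjectionOnto_apply_le _ x

theorem op_proj (s : S) (x : H) :
    V.op s ((V.dom (star s)).orthogonalProjectionOnto x : H) = V.op s x := by
  rw [op_apply, op_apply, Submodule.orthogonalProjectionOnto_mem_subspace_eq_self]

theorem op_op_star_eq_proj (s : S) (x : H) :
    V.op s (V.op (star s) x) = ((V.dom s).orthogonalProjectionOnto x : H) := by
  have h : ∀ t, t = s →
      V.op (star s) ((V.dom t).orthogonalProjectionOnto x : H) = V.op (star s) x → 
      V.op (star s) ((V.dom s).orthogonalProjectionOnto x : H) = V.op (star s) x := by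
    rintro t rfl h; exact h
  rw [← h _ (starstar s) (V.op_proj (star s) x)]
  exact V.op_op_star s _ (Subtype.property _)

theorem inner_op_op (s : S) (x y : H) (hx : x ∈ V.dom (star s)) (hy : y ∈ V.dom (star s)) :
    inner ℂ (V.op s x) (V.op s y) = inner ℂ x y := by
  rw [V.op_apply_of_mem s x hx, V.op_apply_of_mem s y hy, ← Submodule.coe_inner,
    LinearIsometryEquiv.inner_map_map, Submodule.coe_inner]

theorem inner_op (s : S) (x y : H) : inner ℂ (V.op (star s) x) y = inner ℂ x (V.op s y) := by
  calc inner ℂ (V.op (star s) x) y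
      = inner ℂ (V.op (star s) x) ((V.dom (star s)).orthogonalProjectionOnto y : H) :=
        (Submodule.inner_orthogonalProjectionOnto_eq_of_mem_left
          (⟨_, V.op_mem (star s) x⟩ : V.dom (star s)) y).symm
    _ = inner ℂ (V.op s (V.op (star s) x)) (V.op s y) := by
        rw [← V.op_proj s y, V.inner_op_op s _ _ (V.op_mem _ _) (Subtype.property _)]
    _ = inner ℂ x (V.op s y) := by
        rw [op_op_star_eq_proj]
        exact Submodule.inner_orthogonalProjectionOnto_eq_of_mem_right
          (⟨_, V.op_mem s y⟩ : V.dom s) x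

theorem star_op (s : S) : star (V.op s) = V.op (star s) := by
  rw [ContinuousLinearMap.star_eq_adjoint]
  exact ((ContinuousLinearMap.eq_adjoint_iff _ _).2 fun x y => V.inner_op s x y).symm

end PartialRep

section Covariant

variable {S : Type v} [InverseMonoid S] {A : Type u} [NonUnitalCStarAlgebra A]

/-- A covariant representation `(π, v)` of a partial action on a Hilbert space `H`: a
`⋆`-homomorphism `π : A → B(H)` and a partial representation `v` of `S` on `H` such that
`π(A_s) H` (the closed linear span) is the final space `v_s v_{s⋆} H` of `v_s` and
`π(θ_s(a)) = v_s π(a) v_{s⋆}` for `a ∈ A_{s⋆}`. -/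
structure CovariantRep (α : PartialCStarAction S A) (H : Type w) [NormedAddCommGroup H]
    [InnerProductSpace ℂ H] [CompleteSpace H] where
  π : A →⋆ₙₐ[ℂ] (H →L[ℂ] H)
  v : PartialRep S H
  range_eq : ∀ s, (Submodule.span ℂ {y : H | ∃ a ∈ α.dom s, ∃ x, π a x = y}).topologicalClosure
    = v.dom s
  covariant : ∀ s (a : α.dom (star s)), π (α.act s a) = v.op s * π a * v.op (star s)

namespace CovariantRep

variable {α : PartialCStarAction S A} {H : Type w} [NormedAddCommGroup H]
    [InnerProductSpace ℂ H] [CompleteSpace H] (ρ : CovariantRep α H)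

/-- The integrated form `π ⋊ v : C_c(S, A) → B(H)`, `a u_s ↦ π(a) v_s`. -/
noncomputable def integrated : α.Cc →ₗ[ℂ] (H →L[ℂ] H) :=
  PartialCStarAction.Cc.lift α fun s =>
    LinearMap.mulRight ℂ (ρ.v.op s) ∘ₗ (ρ.π : A →ₗ[ℂ] (H →L[ℂ] H)) ∘ₗ
      (α.dom s).toNonUnitalSubalgebra.toSubmodule.subtype

@[simp]
theorem integrated_single (s : S) (a : α.dom s) :
    ρ.integrated (PartialCStarAction.Cc.single α s a) = ρ.π a * ρ.v.op s := by
  rw [integrated, PartialCStarAction.Cc.lift_single]; rfl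

theorem π_mem (s : S) (a : A) (ha : a ∈ α.dom s) (x : H) : ρ.π a x ∈ ρ.v.dom s := by
  rw [← ρ.range_eq]
  exact Submodule.le_topologicalClosure _ (Submodule.subset_span ⟨a, ha, x, rfl⟩)

theorem op_op_star_π (s : S) (a : A) (ha : a ∈ α.dom s) :
    ρ.v.op s * ρ.v.op (star s) * ρ.π a = ρ.π a := by
  ext x
  exact ρ.v.op_op_star s _ (ρ.π_mem s a ha x)

theorem op_star_op_π (s : S) (a : A) (ha : a ∈ α.dom (star s)) :
    ρ.v.op (star s) * ρ.v.op s * ρ.π a = ρ.π a := by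
  ext x
  exact ρ.v.op_star_op s _ (ρ.π_mem _ a ha x)

theorem π_op_op_star (s : S) (a : A) (ha : a ∈ α.dom s) :
    ρ.π a * ρ.v.op s * ρ.v.op (star s) = ρ.π a := by
  have h := congrArg star (ρ.op_op_star_π s (star a) (star_mem ha))
  rw [star_mul, star_mul, ρ.v.star_op, ρ.v.star_op, starstar, ← map_star, star_star,
    ← mul_assoc] at h
  exact h

theorem π_op_star_op (s : S) (a : A) (ha : a ∈ α.dom (star s)) :
    ρ.π a * ρ.v.op (star s) * ρ.v.op s = ρ.π a := by
  have := ρ.π_op_op_star (star s) a ha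
  rwa [starstar] at this

/-- `π(d) v_{s⋆} v_{st} = π(d) v_t` for `d ∈ A_{s⋆} ∩ A_t`. -/
theorem π_op_star_op_mul (s t : S) (d : A) (hs : d ∈ α.dom (star s)) (ht : d ∈ α.dom t) :
    ρ.π d * ρ.v.op (star s) * ρ.v.op (s * t) = ρ.π d * ρ.v.op t := by
  rw [← star_inj, star_mul, star_mul, star_mul, ρ.v.star_op, ρ.v.star_op, ρ.v.star_op, starstar,
    ← map_star, star_mul_rev]
  ext y
  set x := ρ.π (star d) y with hx
  have hxs : x ∈ ρ.v.dom (star s) := ρ.π_mem _ _ (star_mem hs) y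
  have hxt : x ∈ ρ.v.dom t := ρ.π_mem _ _ (star_mem ht) y
  have h1 : ρ.v.op (star s) (ρ.v.op s x) = x := ρ.v.op_star_op s x hxs
  have h2 := ρ.v.op_mul_apply (star s) (star t) (ρ.v.op s x)
    (by rw [starstar]; exact ρ.v.op_mem s x) (by rw [h1, starstar]; exact hxt)
  rw [h1] at h2
  exact h2

theorem integrated_mul (f g : α.Cc) :
    ρ.integrated (f * g) = ρ.integrated f * ρ.integrated g := by
  simp only [PartialCStarAction.Cc.mul_def]
  induction f using PartialCStarAction.Cc.induction with
  | zero => simp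
  | add f f' hf hf' => simp [add_mul, hf, hf']
  | single s a =>
    induction g using PartialCStarAction.Cc.induction with
    | zero => simp
    | add g g' hg hg' => simp [mul_add, hg, hg']
    | single t b =>
      rw [← PartialCStarAction.Cc.mul_def, PartialCStarAction.Cc.single_mul_single,
        integrated_single, integrated_single, integrated_single,
        PartialCStarAction.Cc.coe_mulSingle, ρ.covariant]
      set a' := α.actStar s a with ha'
      have ha : (a : A) = α.act s a' := by rw [ha', α.act_actStar]
      rw [ha, ρ.covariant]
      have h1 := ρ.π_op_star_op_mul s t (a' * b) (α.mul_mem_right _ _ _ a'.2)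
        (α.mul_mem_left _ _ _ b.2)
      have h2 := ρ.π_op_star_op s a' a'.2
      calc _ = ρ.v.op s * (ρ.π (a' * b) * ρ.v.op (star s) * ρ.v.op (s * t)) := by
            simp only [mul_assoc]
        _ = ρ.v.op s * (ρ.π a' * ρ.v.op (star s) * ρ.v.op s) * ρ.π b * ρ.v.op t := by
            rw [h1, h2, map_mul]; simp only [mul_assoc]
        _ = _ := by simp only [mul_assoc]

theorem integrated_star (f : α.Cc) : ρ.integrated (star f) = star (ρ.integrated f) := by
  induction f using PartialCStarAction.Cc.induction with
  | zero => simp [PartialCStarAction.Cc.star_zero']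
  | add f f' hf hf' => simp [PartialCStarAction.Cc.star_add', hf, hf']
  | single s a =>
    rw [PartialCStarAction.Cc.star_single, integrated_single, integrated_single, star_mul,
      ρ.v.star_op, ← map_star, PartialCStarAction.actStar, ρ.covariant]
    have h := ρ.π_op_op_star s (star (a : A)) (star_mem a.2)
    calc _ = ρ.v.op (star s) * (ρ.π (star (a : A)) * ρ.v.op (star (star s)) *
              ρ.v.op (star s)) := by
          simp only [mul_assoc]; rfl
      _ = _ := by rw [starstar, h]

theorem norm_integrated_single_le (s : S) (a : α.dom s) :
    ‖ρ.integrated (PartialCStarAction.Cc.single α s a)‖ ≤ ‖(a : A)‖ := by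
  rw [integrated_single]
  refine (norm_mul_le _ _).trans ?_
  have h1 : ‖ρ.π (a : A)‖ ≤ ‖(a : A)‖ := NonUnitalStarAlgHom.norm_apply_le ρ.π (a : A)
  calc _ ≤ ‖(a : A)‖ * 1 := mul_le_mul h1 (ρ.v.norm_op_le s) (norm_nonneg _) (norm_nonneg _)
    _ = _ := mul_one _

end CovariantRep

/-- A covariant representation on some Hilbert space. The universe is large enough: the norm of
`(π ⋊ v)(f)` is always the supremum over the cyclic subrepresentations. -/
structure SomeCovariantRep (α : PartialCStarAction S A) where
  H : Type (max u v)
  [normedAddCommGroup : NormedAddCommGroup H]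
  [innerProductSpace : InnerProductSpace ℂ H]
  [completeSpace : CompleteSpace H]
  rep : CovariantRep α H

attribute [instance] SomeCovariantRep.normedAddCommGroup SomeCovariantRep.innerProductSpace
  SomeCovariantRep.completeSpace

end Covariant

namespace PartialCStarAction

variable {S : Type v} [InverseMonoid S] {A : Type u} [NonUnitalCStarAlgebra A]
  {α : PartialCStarAction S A}

namespace Cc

/-- The seminorm `‖f‖ = sup ‖(π ⋊ v)(f)‖` over all covariant representations `(π, v)`. -/
noncomputable instance : Norm α.Cc := ⟨fun f => ⨆ ρ : SomeCovariantRep α, ‖ρ.rep.integrated f‖⟩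

theorem norm_def (f : α.Cc) : ‖f‖ = ⨆ ρ : SomeCovariantRep α, ‖ρ.rep.integrated f‖ := rfl

theorem bddAbove_norm (f : α.Cc) :
    BddAbove (Set.range fun ρ : SomeCovariantRep α => ‖ρ.rep.integrated f‖) := by
  suffices h : ∃ C : ℝ, ∀ ρ : SomeCovariantRep α, ‖ρ.rep.integrated f‖ ≤ C by
    obtain ⟨C, hC⟩ := h
    exact ⟨C, by rintro _ ⟨ρ, rfl⟩; exact hC ρ⟩
  induction f using Cc.induction with
  | zero => exact ⟨0, by simp⟩
  | single s a => exact ⟨‖(a : A)‖, fun ρ => ρ.rep.norm_integrated_single_le s a⟩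
  | add f g hf hg =>
    obtain ⟨C, hC⟩ := hf
    obtain ⟨D, hD⟩ := hg
    exact ⟨C + D, fun ρ => by
      rw [map_add]; exact (norm_add_le _ _).trans (add_le_add (hC ρ) (hD ρ))⟩

theorem norm_integrated_le (ρ : SomeCovariantRep α) (f : α.Cc) : ‖ρ.rep.integrated f‖ ≤ ‖f‖ :=
  le_ciSup (bddAbove_norm f) ρ

theorem norm_nonneg' (f : α.Cc) : 0 ≤ ‖f‖ := Real.iSup_nonneg fun _ => norm_nonneg _

theorem norm_le_of_forall {f : α.Cc} {C : ℝ} (hC : 0 ≤ C)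
    (h : ∀ ρ : SomeCovariantRep α, ‖ρ.rep.integrated f‖ ≤ C) : ‖f‖ ≤ C :=
  Real.iSup_le h hC

theorem norm_smul_le' (c : ℂ) (f : α.Cc) : ‖c • f‖ ≤ ‖c‖ * ‖f‖ :=
  norm_le_of_forall (mul_nonneg (norm_nonneg _) (norm_nonneg' _)) fun ρ => by
    rw [map_smul, norm_smul]
    exact mul_le_mul_of_nonneg_left (norm_integrated_le ρ f) (norm_nonneg _)

noncomputable instance : SeminormedAddCommGroup α.Cc :=
  AddGroupSeminorm.toSeminormedAddCommGroup
    { toFun := fun f => ‖f‖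
      map_zero' := le_antisymm (norm_le_of_forall le_rfl (by simp)) (norm_nonneg' _)
      add_le' := fun f g => norm_le_of_forall (add_nonneg (norm_nonneg' _) (norm_nonneg' _))
        fun ρ => by
          rw [map_add]
          exact (norm_add_le _ _).trans
            (add_le_add (norm_integrated_le ρ f) (norm_integrated_le ρ g))
      neg' := fun f => by simp [norm_def] }

noncomputable instance : NormedSpace ℂ α.Cc where
  norm_smul_le := norm_smul_le'

theorem norm_mul_le' (f g : α.Cc) : ‖f * g‖ ≤ ‖f‖ * ‖g‖ :=
  norm_le_of_forall (mul_nonneg (norm_nonneg _) (norm_nonneg _)) fun ρ => by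
    rw [ρ.rep.integrated_mul]
    exact (norm_mul_le _ _).trans (mul_le_mul (norm_integrated_le ρ f) (norm_integrated_le ρ g)
      (norm_nonneg _) (norm_nonneg _))

theorem norm_star' (f : α.Cc) : ‖star f‖ = ‖f‖ := by
  simp only [norm_def, CovariantRep.integrated_star, norm_star]

theorem norm_sq_le (f : α.Cc) : ‖f‖ * ‖f‖ ≤ ‖star f * f‖ := by
  have h : ‖f‖ ≤ √‖star f * f‖ := norm_le_of_forall (Real.sqrt_nonneg _) fun ρ => by
    apply Real.le_sqrt_of_sq_le
    rw [sq, ← CStarRing.norm_star_mul_self, ← ρ.rep.integrated_star, ← ρ.rep.integrated_mul]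
    exact norm_integrated_le ρ _
  calc ‖f‖ * ‖f‖ ≤ √‖star f * f‖ * √‖star f * f‖ :=
        mul_le_mul h h (norm_nonneg _) (Real.sqrt_nonneg _)
    _ = _ := Real.mul_self_sqrt (norm_nonneg _)

theorem norm_sub_eq_zero {f g : α.Cc}
    (h : ∀ ρ : SomeCovariantRep α, ρ.rep.integrated f = ρ.rep.integrated g) : ‖f - g‖ = 0 :=
  le_antisymm (norm_le_of_forall le_rfl fun ρ => by rw [map_sub, h, sub_self, norm_zero])
    (norm_nonneg _)

variable (α) in
/-- The product of `C_c(S, A)` as a continuous bilinear map. -/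
noncomputable def mulL : α.Cc →L[ℂ] α.Cc →L[ℂ] α.Cc :=
  (mulₗ α).mkContinuous₂ 1 fun f g => by rw [one_mul]; exact norm_mul_le' f g

theorem norm_mulL_le (f : α.Cc) : ‖mulL α f‖ ≤ ‖f‖ :=
  ContinuousLinearMap.opNorm_le_bound _ (norm_nonneg _) fun g => norm_mul_le' f g

theorem continuous_starₐ : Continuous (starₐ : α.Cc →+ α.Cc) :=
  AddMonoidHomClass.continuous_of_bound starₐ 1 fun f => by rw [one_mul]; exact (norm_star' f).le

end Cc

/-- The crossed product `A ⋊ S`: the Hausdorff completion of `C_c(S, A)`. -/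
def CrossedProduct (α : PartialCStarAction S A) : Type (max u v) := UniformSpace.Completion α.Cc

namespace CrossedProduct

open UniformSpace

noncomputable instance : NormedAddCommGroup α.CrossedProduct :=
  inferInstanceAs (NormedAddCommGroup (Completion α.Cc))
noncomputable instance : NormedSpace ℂ α.CrossedProduct :=
  inferInstanceAs (NormedSpace ℂ (Completion α.Cc))
instance : CompleteSpace α.CrossedProduct :=
  inferInstanceAs (CompleteSpace (Completion α.Cc))

variable (α) in
/-- The canonical map `C_c(S, A) → A ⋊ S`. -/
noncomputable def of : α.Cc →L[ℂ] α.CrossedProduct := Completion.toComplL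

@[simp]
theorem norm_of (f : α.Cc) : ‖of α f‖ = ‖f‖ := Completion.norm_coe f

theorem denseRange_of : DenseRange (of α) := Completion.denseRange_coe

theorem of_eq_of {f g : α.Cc}
    (h : ∀ ρ : SomeCovariantRep α, ρ.rep.integrated f = ρ.rep.integrated g) :
    of α f = of α g := by
  rw [← sub_eq_zero, ← map_sub, ← norm_eq_zero, norm_of]
  exact Cc.norm_sub_eq_zero h

theorem isUniformInducing_of : IsUniformInducing (of α) := Completion.isUniformInducing_coe _

theorem ext_of {F : Type*} [NormedAddCommGroup F] [NormedSpace ℂ F]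
    {T U : α.CrossedProduct →L[ℂ] F} (h : ∀ f, T (of α f) = U (of α f)) : T = U :=
  ContinuousLinearMap.ext fun x =>
    congrFun (denseRange_of.equalizer T.continuous U.continuous (funext h)) x

theorem induction {p : α.CrossedProduct → Prop} (hp : IsClosed {x | p x})
    (h : ∀ f, p (of α f)) (x : α.CrossedProduct) : p x :=
  isClosed_property denseRange_of hp h x

/-- Left multiplication by an element of `C_c(S, A)`. -/
noncomputable def leftMul (f : α.Cc) : α.CrossedProduct →L[ℂ] α.CrossedProduct :=
  ((of α).comp (Cc.mulL α f)).extend (of α)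

@[simp]
theorem leftMul_of (f g : α.Cc) : leftMul f (of α g) = of α (f * g) :=
  ContinuousLinearMap.extend_eq _ denseRange_of isUniformInducing_of g

theorem norm_leftMul_le (f : α.Cc) : ‖leftMul f‖ ≤ ‖f‖ := by
  refine ContinuousLinearMap.opNorm_le_bound _ (norm_nonneg _) fun x => ?_
  induction x using induction with
  | hp => exact isClosed_le (by fun_prop) (by fun_prop)
  | h g => rw [leftMul_of, norm_of, norm_of]; exact Cc.norm_mul_le' f g

variable (α) in
/-- Left multiplication by elements of `C_c(S, A)` as a continuous linear map. -/
noncomputable def leftMulL : α.Cc →L[ℂ] α.CrossedProduct →L[ℂ] α.CrossedProduct :=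
  LinearMap.mkContinuous
    { toFun := leftMul
      map_add' := fun f f' => ext_of fun g => by
        simp [Cc.mul_def]
      map_smul' := fun c f => ext_of fun g => by
        simp [Cc.mul_def] } 1
    fun f => by rw [one_mul]; exact norm_leftMul_le f

variable (α) in
/-- The product of `A ⋊ S`, the continuous extension of the product of `C_c(S, A)`. -/
noncomputable def mulL : α.CrossedProduct →L[ℂ] α.CrossedProduct →L[ℂ] α.CrossedProduct :=
  (leftMulL α).extend (of α)

noncomputable instance : Mul α.CrossedProduct := ⟨fun x y => mulL α x y⟩

theorem mul_def (x y : α.CrossedProduct) : x * y = mulL α x y := rfl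

theorem of_mul (f g : α.Cc) : of α (f * g) = of α f * of α g := by
  rw [mul_def, mulL, ContinuousLinearMap.extend_eq _ denseRange_of isUniformInducing_of]
  exact (leftMul_of f g).symm

instance : ContinuousMul α.CrossedProduct :=
  ⟨by
    change Continuous fun p : α.CrossedProduct × α.CrossedProduct => mulL α p.1 p.2
    fun_prop⟩

/-- The involution of `A ⋊ S`, the continuous extension of the involution of `C_c(S, A)`. -/
noncomputable instance : Star α.CrossedProduct :=
  ⟨((Cc.starₐ : α.Cc →+ α.Cc).completion Cc.continuous_starₐ :
    Completion α.Cc →+ Completion α.Cc)⟩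

theorem of_star (f : α.Cc) : of α (star f) = star (of α f) :=
  ((Cc.starₐ : α.Cc →+ α.Cc).completion_coe Cc.continuous_starₐ f).symm

theorem continuous_star' : Continuous (star : α.CrossedProduct → α.CrossedProduct) :=
  (Cc.starₐ : α.Cc →+ α.Cc).continuous_completion Cc.continuous_starₐ

noncomputable instance : NonUnitalNormedRing α.CrossedProduct where
  left_distrib x y z := by simp [mul_def]
  right_distrib x y z := by simp [mul_def]
  zero_mul x := by simp [mul_def]
  mul_zero x := by simp [mul_def]
  mul_assoc x y z := by
    induction x using induction with
    | hp => exact isClosed_eq (by fun_prop) (by fun_prop)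
    | h f =>
      induction y using induction with
      | hp => exact isClosed_eq (by fun_prop) (by fun_prop)
      | h g =>
        induction z using induction with
        | hp => exact isClosed_eq (by fun_prop) (by fun_prop)
        | h k =>
          rw [← of_mul, ← of_mul, ← of_mul, ← of_mul]
          exact of_eq_of fun ρ => by simp only [CovariantRep.integrated_mul, mul_assoc]
  dist_eq x y := dist_eq_norm_neg_add x y
  norm_mul_le x y := by
    induction x using induction with
    | hp => exact isClosed_le (by fun_prop) (by fun_prop)
    | h f =>
      induction y using induction with
      | hp => exact isClosed_le (by fun_prop) (by fun_prop)
      | h g =>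
        rw [← of_mul, norm_of, norm_of, norm_of]
        exact Cc.norm_mul_le' f g

noncomputable instance : StarRing α.CrossedProduct where
  star_involutive x := by
    induction x using induction with
    | hp => exact isClosed_eq (continuous_star'.comp continuous_star') continuous_id
    | h f =>
      rw [← of_star, ← of_star]
      exact of_eq_of fun ρ => by simp only [CovariantRep.integrated_star, star_star]
  star_mul x y := by
    induction x using induction with
    | hp =>
      exact isClosed_eq (continuous_star'.comp (by fun_prop))
        (continuous_const.mul continuous_star')
    | h f =>
      induction y using induction with
      | hp =>
        exact isClosed_eq (continuous_star'.comp (by fun_prop))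
          (continuous_star'.mul continuous_const)
      | h g =>
        rw [← of_mul, ← of_star, ← of_star, ← of_star, ← of_mul]
        exact of_eq_of fun ρ => by
          simp only [CovariantRep.integrated_star, CovariantRep.integrated_mul, star_mul]
  star_add x y := map_add ((Cc.starₐ : α.Cc →+ α.Cc).completion Cc.continuous_starₐ) x y

theorem star_smul' (c : ℂ) (x : α.CrossedProduct) : star (c • x) = star c • star x := by
  induction x using induction with
  | hp =>
    have h1 : Continuous fun x : α.CrossedProduct => c • x := continuous_const_smul c
    have h2 : Continuous fun x : α.CrossedProduct => star c • x := continuous_const_smul (star c)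
    exact isClosed_eq (continuous_star'.comp h1) (h2.comp continuous_star')
  | h f =>
    rw [← map_smul, ← of_star, ← of_star, ← map_smul]
    exact of_eq_of fun ρ => by
      simp only [CovariantRep.integrated_star, map_smul, star_smul]

noncomputable instance : NonUnitalCStarAlgebra α.CrossedProduct where
  norm_mul_self_le x := by
    induction x using induction with
    | hp => exact isClosed_le (by fun_prop) ((continuous_star'.mul continuous_id).norm)
    | h f =>
      rw [← of_star, ← of_mul, norm_of, norm_of]
      exact Cc.norm_sq_le f
  smul_assoc c x y := by simp [mul_def]
  smul_comm c x y := by simp [mul_def]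
  star_smul := star_smul'

/-- The order of `A ⋊ S` as a C⋆-algebra. -/
noncomputable instance : PartialOrder α.CrossedProduct := CStarAlgebra.spectralOrder _
instance : StarOrderedRing α.CrossedProduct := CStarAlgebra.spectralOrderedRing _

end CrossedProduct

/-- The linear map `C_c(S, A) → C_c(S, B)`, `a u_s ↦ φ(a) u_s`, of an equivariant linear map
`φ : A → B`. -/
noncomputable def IsEquivariant.mapCc {B : Type w} [NonUnitalCStarAlgebra B]
    {β : PartialCStarAction S B} {φ : A →ₗ[ℂ] B} (h : IsEquivariant α β φ) : α.Cc →ₗ[ℂ] β.Cc :=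
  Cc.lift α fun s => Cc.single β s ∘ₗ
    (φ.restrict (p := (α.dom s).toNonUnitalSubalgebra.toSubmodule)
      (q := (β.dom s).toNonUnitalSubalgebra.toSubmodule) (h.mapsTo s))

@[simp]
theorem IsEquivariant.mapCc_single {B : Type w} [NonUnitalCStarAlgebra B]
    {β : PartialCStarAction S B} {φ : A →ₗ[ℂ] B} (h : IsEquivariant α β φ) (s : S)
    (a : α.dom s) : h.mapCc (Cc.single α s a) = Cc.single β s ⟨φ a, h.mapsTo s a a.2⟩ := by
  rw [mapCc, Cc.lift_single]; rfl

end PartialCStarAction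

/-! ### Positivity of matrices over a C⋆-algebra, tested by quadratic forms. -/

section Gram

open ComplexOrder

/-! The proof is a covariant Stinespring dilation. Let `(π, v)` be a covariant representation of `B`
on `H` and put `T = π ∘ φ`. On the Hilbert space `K` spanned by symbols `a ⊗ x` with `⟨a ⊗ x, b ⊗ y⟩
= ⟨x, T (a⋆ b) y⟩` (written `e a x` below), set `σ(a)(b ⊗ x) = ab ⊗ x` and, for `a ∈ A_{s⋆}`, `w_s(a
⊗ x) = θ_s(a) ⊗ v_s x`. Equivariance makes `w_s` isometric from `K_{s⋆}` onto `K_s`, where `K_s` is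
the closed span of `A_s ⊗ H`, and `(σ, w)` is a covariant representation of `A`
(`exists_covariantRep`). The delicate axiom is multiplicativity of `w`: it needs `K_s ∩ K_t` to be
spanned by `(A_s ∩ A_t) ⊗ H` (`mem_stinespringSpan_inter`).

The map `R : a ⊗ x ↦ T(a) x` satisfies `‖R‖² ≤ C` whenever `‖φ a‖ ≤ C ‖a‖`, and `R⋆ y` plays the
role of `1 ⊗ y`, although `A` need not have a unit. Hence `(π ⋊ v)(φ̃ f) = R (σ ⋊ w)(f) R⋆` on
`C_c(S, A)` (`exists_dilation`).

Everything follows from this formula. It gives `‖φ̃ f‖ ≤ C ‖f‖`, so `φ̃` extends to the completion,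
contractively if `C = 1`. It also turns `φ̃` of a matrix `N⋆ N` into a sum of squares in every
covariant representation. These representations are jointly faithful on `B ⋊ S` and detect
positivity of matrices, so `φ̃` is completely positive. -/

theorem exists_eq_star_mul_self_of_nonneg {D : Type*} [NonUnitalCStarAlgebra D] [PartialOrder D]
    [StarOrderedRing D] {a : D} (ha : 0 ≤ a) : ∃ b, a = star b * b :=
  CStarAlgebra.nonneg_iff_eq_star_mul_self.1 ha

/-- A witness for the failure of nonnegativity of a selfadjoint element. -/
theorem exists_conjugate_eq_neg_star_mul_self {D : Type*} [NonUnitalCStarAlgebra D]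
    [PartialOrder D] [StarOrderedRing D] {a : D} (ha : IsSelfAdjoint a) :
    ∃ n r : D, star n * a * n = -(star r * r) ∧ (r = 0 → 0 ≤ a) := by
  have hn0 : 0 ≤ a⁻ := CFC.negPart_nonneg a
  have hns : star a⁻ = a⁻ := (IsSelfAdjoint.of_nonneg hn0).star_eq
  -- Since `a = a⁺ - a⁻` and `a⁺ a⁻ = 0`, conjugating `a` by its negative part leaves `-(a⁻)³`.
  have hn : star a⁻ * a * a⁻ = -(star a⁻ * a⁻ * a⁻) := by
    have h : a * a⁻ = -(a⁻ * a⁻) := by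
      nth_rw 1 [← CFC.posPart_sub_negPart a ha]
      rw [sub_mul, CFC.posPart_mul_negPart, zero_sub]
    rw [mul_assoc, h, mul_neg, mul_assoc]
  obtain ⟨r, hr⟩ := exists_eq_star_mul_self_of_nonneg (star_left_conjugate_nonneg hn0 a⁻)
  refine ⟨a⁻, r, by rw [hn, hr], fun h => ?_⟩
  -- If `(a⁻)³ = 0` then `(a⁻)⁴ = 0`, and two uses of the C⋆-identity give `a⁻ = 0`.
  have h4 : star (star a⁻ * a⁻) * (star a⁻ * a⁻) = 0 := by
    rw [h, mul_zero] at hr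
    rw [hns] at hr ⊢
    rw [star_mul, hns, ← mul_assoc, hr, zero_mul]
  rw [CStarRing.star_mul_self_eq_zero_iff, CStarRing.star_mul_self_eq_zero_iff] at h4
  exact (CFC.negPart_eq_zero_iff a ha).1 h4

theorem sum_inner_self_nonneg {n H : Type*} [Fintype n] [NormedAddCommGroup H]
    [InnerProductSpace ℂ H] (y : n → H) :
    0 ≤ ∑ l, inner ℂ (y l) (y l) :=
  Finset.sum_nonneg fun l _ => by rw [inner_self_eq_norm_sq_to_K]; positivity

variable {n : Type*} [Fintype n] {B H : Type*} [NonUnitalCStarAlgebra B] [NormedAddCommGroup H]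
  [InnerProductSpace ℂ H] [CompleteSpace H]

/-- Conjugating by `N` amounts to substituting the vector `π(N) x` for `x` in the quadratic form of
`M`. -/
theorem CStarMatrix.sum_inner_map_conjugate (π : B →⋆ₙₐ[ℂ] (H →L[ℂ] H))
    (N M : CStarMatrix n n B) (x : n → H) :
    ∑ i, ∑ j, inner ℂ (x i) (π ((star N * M * N) i j) (x j)) =
      ∑ k, ∑ l, inner ℂ (∑ i, π (N k i) (x i)) (π (M k l) (∑ j, π (N l j) (x j))) := by
  have h : ∀ i j, inner ℂ (x i) (π ((star N * M * N) i j) (x j)) =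
      ∑ k, ∑ l, inner ℂ (π (N k i) (x i)) (π (M k l) (π (N l j) (x j))) := by
    intro i j
    rw [Finset.sum_comm]
    simp [CStarMatrix.mul_apply, CStarMatrix.star_apply, map_sum, map_mul, map_star,
      ContinuousLinearMap.star_eq_adjoint,
      ContinuousLinearMap.adjoint_inner_right, Finset.sum_mul, sum_apply]
  simp only [h, map_sum, sum_inner, inner_sum]
  calc _ = ∑ i, ∑ k, ∑ l, ∑ j, inner ℂ (π (N k i) (x i)) (π (M k l) (π (N l j) (x j))) :=
        Finset.sum_congr rfl fun i _ => by
          rw [Finset.sum_comm]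
          exact Finset.sum_congr rfl fun k _ => Finset.sum_comm
    _ = ∑ k, ∑ i, ∑ l, ∑ j, inner ℂ (π (N k i) (x i)) (π (M k l) (π (N l j) (x j))) :=
        Finset.sum_comm
    _ = ∑ k, ∑ l, ∑ i, ∑ j, inner ℂ (π (N k i) (x i)) (π (M k l) (π (N l j) (x j))) :=
        Finset.sum_congr rfl fun k _ => Finset.sum_comm
    _ = _ := Finset.sum_congr rfl fun k _ => Finset.sum_congr rfl fun l _ => Finset.sum_comm

/-- The case `M = 1` of the conjugation formula, proved separately because `B` need not have a unit.
-/
theorem CStarMatrix.sum_inner_map_star_mul_self (π : B →⋆ₙₐ[ℂ] (H →L[ℂ] H))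
    (N : CStarMatrix n n B) (x : n → H) :
    ∑ i, ∑ j, inner ℂ (x i) (π ((star N * N) i j) (x j)) =
      ∑ l, inner ℂ (∑ j, π (N l j) (x j)) (∑ j, π (N l j) (x j)) := by
  have h : ∀ i j, inner ℂ (x i) (π ((star N * N) i j) (x j)) =
      ∑ l, inner ℂ (π (N l i) (x i)) (π (N l j) (x j)) := by
    intro i j
    simp [CStarMatrix.mul_apply, CStarMatrix.star_apply, map_sum, map_mul, map_star,
      ContinuousLinearMap.star_eq_adjoint,
      ContinuousLinearMap.adjoint_inner_right, sum_apply]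
  simp only [h, sum_inner, inner_sum]
  calc _ = ∑ i, ∑ l, ∑ j, inner ℂ (π (N l i) (x i)) (π (N l j) (x j)) :=
        Finset.sum_congr rfl fun i _ => Finset.sum_comm
    _ = _ := Finset.sum_comm
    _ = _ := Finset.sum_congr rfl fun l _ => Finset.sum_comm

/-- A `⋆`-homomorphism into `B(H)` maps nonnegative matrices to nonnegative forms. -/
theorem CStarMatrix.sum_inner_nonneg [PartialOrder B] [StarOrderedRing B]
    (π : B →⋆ₙₐ[ℂ] (H →L[ℂ] H)) {M : CStarMatrix n n B} (hM : 0 ≤ M)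
    (x : n → H) : 0 ≤ ∑ i, ∑ j, inner ℂ (x i) (π (M i j) (x j)) := by
  obtain ⟨N, rfl⟩ := exists_eq_star_mul_self_of_nonneg hM
  rw [sum_inner_map_star_mul_self]
  exact sum_inner_self_nonneg _

/-- A selfadjoint matrix is nonnegative if a jointly faithful family of representations maps it
to nonnegative forms. -/
theorem CStarMatrix.nonneg_of_forall_sum_inner_nonneg [PartialOrder B] [StarOrderedRing B]
    {ι : Type*} {H : ι → Type*} [∀ r, NormedAddCommGroup (H r)]
    [∀ r, InnerProductSpace ℂ (H r)] [∀ r, CompleteSpace (H r)]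
    (π : ∀ r, B →⋆ₙₐ[ℂ] (H r →L[ℂ] H r)) (hπ : ∀ b, (∀ r, π r b = 0) → b = 0)
    {M : CStarMatrix n n B} (hM : IsSelfAdjoint M)
    (h : ∀ r (x : n → H r), 0 ≤ ∑ i, ∑ j, inner ℂ (x i) (π r (M i j) (x j))) : 0 ≤ M := by
  obtain ⟨N, R, hNR, hR⟩ := exists_conjugate_eq_neg_star_mul_self hM
  refine hR (CStarMatrix.ext fun l j => hπ _ fun r => ?_)
  -- The form of `M` at `π(N) y` is nonnegative, yet it equals minus this sum of squares.
  have key : ∀ y : n → H r, ∑ l, inner ℂ (∑ j, π r (R l j) (y j)) (∑ j, π r (R l j) (y j)) = 0 := by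
    intro y
    refine le_antisymm ?_ (sum_inner_self_nonneg _)
    have h1 := h r fun k => ∑ i, π r (N k i) (y i)
    rw [← sum_inner_map_conjugate, hNR] at h1
    simpa [sum_inner_map_star_mul_self] using h1
  classical
  ext v
  -- A vector supported at the single index `j` isolates the entry `R l j`.
  have h2 := (Finset.sum_eq_zero_iff_of_nonneg fun l _ => by
    rw [inner_self_eq_norm_sq_to_K]; positivity).1 (key (Pi.single j v)) l (Finset.mem_univ _)
  rw [inner_self_eq_zero, Finset.sum_eq_single j (fun i _ hi => by simp [hi]) (by simp)] at h2
  simpa using h2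

end Gram

/-! ### Operators prescribed on spanning families. -/

section Extension

variable {ι E F : Type*} [NormedAddCommGroup E] [InnerProductSpace ℂ E]
  [NormedAddCommGroup F] [InnerProductSpace ℂ F]

/-- The bound on linear combinations gives well-definedness and continuity at once. Both `σ(a)` and
`R` are constructed this way. -/
theorem exists_continuousLinearMap_of_dense_span [CompleteSpace F] (ξ : ι → E) (η : ι → F)
    (hd : (Submodule.span ℂ (Set.range ξ)).topologicalClosure = ⊤) (C : ℝ)
    (h : ∀ c : ι →₀ ℂ, ‖Finsupp.linearCombination ℂ η c‖ ≤
      C * ‖Finsupp.linearCombination ℂ ξ c‖) :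
    ∃ T : E →L[ℂ] F, (∀ i, T (ξ i) = η i) ∧ ∀ x, ‖T x‖ ≤ C * ‖x‖ := by
  have hdr : DenseRange (Finsupp.linearCombination ℂ ξ) := by
    have := Submodule.dense_iff_topologicalClosure_eq_top.2 hd
    rw [← Finsupp.range_linearCombination] at this
    exact this
  refine ⟨(Finsupp.linearCombination ℂ η).extendOfNorm (Finsupp.linearCombination ℂ ξ),
    fun i => ?_, LinearMap.norm_extendOfNorm_apply_le hdr C h⟩
  have := LinearMap.extendOfNorm_eq (f := Finsupp.linearCombination ℂ η) hdr ⟨C, h⟩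
    (Finsupp.single i 1)
  simpa using this

theorem inner_linearCombination (ξ η : ι → E) (c d : ι →₀ ℂ) :
    inner ℂ (Finsupp.linearCombination ℂ ξ c) (Finsupp.linearCombination ℂ η d) =
      c.sum fun i z => d.sum fun j w => star z * w * inner ℂ (ξ i) (η j) := by
  rw [Finsupp.linearCombination_apply, Finsupp.linearCombination_apply, Finsupp.sum_inner]
  refine Finsupp.sum_congr fun i _ => ?_
  rw [Finsupp.inner_sum]
  refine Finsupp.sum_congr fun j _ => ?_
  rw [inner_smul_left, inner_smul_right, mul_assoc]
  rfl

/-- Equal Gram matrices give linear combinations equal norms. Precomposing with the orthogonal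
projection onto the closed span defines `T` on all of `E`. The operators `w_s` arise from this. -/
theorem exists_isometry_on_closure_span [CompleteSpace E] [CompleteSpace F] (ξ : ι → E)
    (η : ι → F) (h : ∀ i j, inner ℂ (ξ i) (ξ j) = inner ℂ (η i) (η j)) :
    ∃ T : E →L[ℂ] F, (∀ i, T (ξ i) = η i) ∧
      ∀ x ∈ (Submodule.span ℂ (Set.range ξ)).topologicalClosure, ‖T x‖ = ‖x‖ := by
  set D := (Submodule.span ℂ (Set.range ξ)).topologicalClosure with hD
  have hDc : IsClosed (D : Set E) := Submodule.isClosed_topologicalClosure _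
  have : CompleteSpace D := hDc.completeSpace_coe
  have hmem : ∀ c, Finsupp.linearCombination ℂ ξ c ∈ D := fun c =>
    Submodule.le_topologicalClosure _ (by
      rw [← Finsupp.range_linearCombination]; exact ⟨c, rfl⟩)
  let e : (ι →₀ ℂ) →ₗ[ℂ] D := (Finsupp.linearCombination ℂ ξ).codRestrict D hmem
  have he : DenseRange e := by
    intro x
    rw [Metric.mem_closure_iff]
    intro ε hε
    obtain ⟨y, hy, hxy⟩ := Metric.mem_closure_iff.1 (show (x : E) ∈ closure _ from x.2) ε hε
    rw [SetLike.mem_coe, ← Finsupp.range_linearCombination] at hy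
    obtain ⟨c, rfl⟩ := hy
    exact ⟨_, ⟨c, rfl⟩, hxy⟩
  have hn : ∀ c, ‖Finsupp.linearCombination ℂ η c‖ = ‖e c‖ := fun c => by
    have h2 : inner ℂ (Finsupp.linearCombination ℂ η c) (Finsupp.linearCombination ℂ η c) =
      inner ℂ (Finsupp.linearCombination ℂ ξ c) (Finsupp.linearCombination ℂ ξ c) := by
      simp only [inner_linearCombination, h]
    change _ = ‖Finsupp.linearCombination ℂ ξ c‖
    rw [@norm_eq_sqrt_re_inner ℂ, h2, ← @norm_eq_sqrt_re_inner ℂ]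
  let T := (Finsupp.linearCombination ℂ η).extendOfNorm e
  have hT : ∀ c, T (e c) = Finsupp.linearCombination ℂ η c :=
    LinearMap.extendOfNorm_eq he ⟨1, fun c => by rw [hn, one_mul]⟩
  have hT' : ∀ x : D, ‖T x‖ = ‖x‖ := fun x =>
    isClosed_property (p := fun x => ‖T x‖ = ‖x‖) he
      (isClosed_eq (by fun_prop) (by fun_prop)) (fun c => by rw [hT, hn]) x
  have hproj : ∀ x (hx : x ∈ D), D.orthogonalProjectionOnto x = ⟨x, hx⟩ := fun x hx =>
    Submodule.orthogonalProjectionOnto_mem_subspace_eq_self ⟨x, hx⟩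
  refine ⟨T ∘L D.orthogonalProjectionOnto, fun i => ?_, fun x hx => ?_⟩
  · have h1 : ξ i = Finsupp.linearCombination ℂ ξ (Finsupp.single i 1) := by simp
    have h2 : η i = Finsupp.linearCombination ℂ η (Finsupp.single i 1) := by simp
    rw [ContinuousLinearMap.comp_apply, hproj (ξ i) (h1 ▸ hmem _), h2, ← hT]
    exact congrArg T (Subtype.ext h1)
  · rw [ContinuousLinearMap.comp_apply, hproj x hx, hT']; rfl

end Extension

/-! ### The Stinespring space, its representation and the map `R`. -/

section Stinespring

open ComplexOrder Filter Topology

variable {A H K : Type*} [NonUnitalCStarAlgebra A] [NormedAddCommGroup H]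
  [InnerProductSpace ℂ H] [NormedAddCommGroup K] [InnerProductSpace ℂ K]

/-- `e : A → B(H, K)` is a minimal Kolmogorov decomposition of the kernel `(a, b) ↦ T (a⋆ b)`,
i.e. `e a x` is the class of `a ⊗ x` in the Stinespring space of `T`. -/
structure IsStinespring (T : A →L[ℂ] (H →L[ℂ] H)) (e : A →ₗ[ℂ] (H →L[ℂ] K)) : Prop where
  inner_eq : ∀ a b x y, inner ℂ (e a x) (e b y) = inner ℂ x (T (star a * b) y)
  dense : (Submodule.span ℂ (Set.range fun p : A × H => e p.1 p.2)).topologicalClosure = ⊤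

/-- The closed linear span of the vectors `e a x`, `a ∈ J`. -/
def stinespringSpan (e : A →ₗ[ℂ] (H →L[ℂ] K)) (J : Set A) : Submodule ℂ K :=
  (Submodule.span ℂ (Set.range fun p : J × H => e p.1 p.2)).topologicalClosure

theorem isClosed_stinespringSpan (e : A →ₗ[ℂ] (H →L[ℂ] K)) (J : Set A) :
    IsClosed (stinespringSpan e J : Set K) :=
  Submodule.isClosed_topologicalClosure _

theorem mem_stinespringSpan (e : A →ₗ[ℂ] (H →L[ℂ] K)) {J : Set A} {a : A} (ha : a ∈ J) (x : H) :
    e a x ∈ stinespringSpan e J :=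
  Submodule.le_topologicalClosure _ (Submodule.subset_span ⟨(⟨a, ha⟩, x), rfl⟩)

theorem stinespringSpan_le (e : A →ₗ[ℂ] (H →L[ℂ] K)) {J : Set A} {P : Submodule ℂ K}
    (hP : IsClosed (P : Set K)) (h : ∀ a ∈ J, ∀ x, e a x ∈ P) : stinespringSpan e J ≤ P := by
  refine Submodule.topologicalClosure_minimal _ (Submodule.span_le.2 ?_) hP
  rintro _ ⟨p, rfl⟩
  exact h _ p.1.2 _

/-- With the next lemma, this reduces claims about bounded operators on `stinespringSpan e J` to the
generators `e a x`. -/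
theorem apply_mem_of_mem_stinespringSpan {F : Type*} [NormedAddCommGroup F]
    [NormedSpace ℂ F] (e : A →ₗ[ℂ] (H →L[ℂ] K)) {J : Set A} (U : K →L[ℂ] F) {P : Submodule ℂ F}
    (hP : IsClosed (P : Set F)) (h : ∀ a ∈ J, ∀ x, U (e a x) ∈ P) {k : K}
    (hk : k ∈ stinespringSpan e J) : U k ∈ P :=
  stinespringSpan_le e (P := P.comap (U : K →ₗ[ℂ] F)) (hP.preimage U.continuous) h hk

theorem apply_eq_of_mem_stinespringSpan {F : Type*} [NormedAddCommGroup F]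
    [NormedSpace ℂ F] (e : A →ₗ[ℂ] (H →L[ℂ] K)) {J : Set A} (U V : K →L[ℂ] F)
    (h : ∀ a ∈ J, ∀ x, U (e a x) = V (e a x)) {k : K}
    (hk : k ∈ stinespringSpan e J) : U k = V k := by
  have := apply_mem_of_mem_stinespringSpan e (U - V) (P := ⊥) (by simp)
    (fun a ha x => by simp [h a ha x]) hk
  simpa [sub_eq_zero] using this

namespace IsStinespring

variable {T : A →L[ℂ] (H →L[ℂ] H)} {e : A →ₗ[ℂ] (H →L[ℂ] K)} (he : IsStinespring T e)
include he

theorem stinespringSpan_univ : stinespringSpan e Set.univ = ⊤ := by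
  rw [eq_top_iff, ← he.dense]
  refine Submodule.topologicalClosure_mono (Submodule.span_mono ?_)
  rintro _ ⟨p, rfl⟩
  exact ⟨(⟨p.1, trivial⟩, p.2), rfl⟩

theorem ext {F : Type*} [NormedAddCommGroup F] [NormedSpace ℂ F] {U V : K →L[ℂ] F}
    (h : ∀ a x, U (e a x) = V (e a x)) : U = V :=
  ContinuousLinearMap.ext fun _ => apply_eq_of_mem_stinespringSpan e (J := Set.univ) U V
    (fun a _ x => h a x) (he.stinespringSpan_univ ▸ Submodule.mem_top)

theorem eq_of_inner_eq {k l : K} (h : ∀ a x, inner ℂ k (e a x) = inner ℂ l (e a x)) :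
    k = l := by
  have : innerSL ℂ k = innerSL ℂ l := he.ext h
  exact ext_inner_right ℂ fun z => congrArg (fun f : K →L[ℂ] ℂ => f z) this

theorem norm_sq_le (a : A) (x : H) : ‖e a x‖ ^ 2 ≤ ‖T (star a * a)‖ * ‖x‖ ^ 2 := by
  have h := congrArg Complex.re (he.inner_eq a a x x)
  have h2 := inner_self_eq_norm_sq (𝕜 := ℂ) (e a x)
  change (inner ℂ (e a x) (e a x)).re = _ at h2
  rw [← h2, h]
  calc _ ≤ ‖inner ℂ x (T (star a * a) x)‖ := Complex.re_le_norm _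
    _ ≤ ‖x‖ * (‖T (star a * a)‖ * ‖x‖) := (norm_inner_le_norm _ _).trans
        (mul_le_mul_of_nonneg_left (ContinuousLinearMap.le_opNorm _ _) (norm_nonneg _))
    _ = _ := by ring

theorem apply_eq_zero {a : A} {x : H} (h : T (star a * a) x = 0) : e a x = 0 := by
  rw [← inner_self_eq_zero (𝕜 := ℂ), he.inner_eq, h, inner_zero_right]

/-- Converts operator identities for `T` into equalities of vectors in `K`: the norm of `e a (x -
y)` is governed by `T (star a * a) (x - y)`. -/
theorem apply_eq_apply {a : A} {x y : H} (h : T (star a * a) x = T (star a * a) y) :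
    e a x = e a y := by
  rw [← sub_eq_zero, ← map_sub]
  exact he.apply_eq_zero (by rw [map_sub, h, sub_self])

theorem norm_apply_le (x : H) (a : A) : ‖e a x‖ ≤ (√‖T‖ * ‖x‖) * ‖a‖ := by
  refine le_of_sq_le_sq ((he.norm_sq_le a x).trans ?_) (by positivity)
  have : ‖T (star a * a)‖ ≤ ‖T‖ * (‖a‖ * ‖a‖) := by
    rw [← CStarRing.norm_star_mul_self]; exact T.le_opNorm _
  calc _ ≤ ‖T‖ * (‖a‖ * ‖a‖) * ‖x‖ ^ 2 := by gcongr
    _ = (√‖T‖) ^ 2 * (‖a‖ * ‖a‖) * ‖x‖ ^ 2 := by rw [Real.sq_sqrt (norm_nonneg T)]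
    _ = _ := by ring

theorem continuous_apply (x : H) : Continuous fun a => e a x :=
  AddMonoidHomClass.continuous_of_bound
    ({ toFun := fun a => e a x
       map_zero' := by rw [map_zero, zero_apply]
       map_add' := fun a b => by rw [map_add, add_apply] } : A →+ K)
    _ (he.norm_apply_le x)

/-- For a fixed combination, the inner product depends on `d` and `d'` only through `star d * d'`.
The resulting functional is nonnegative on every `star g * g`, so inequalities in `A` pass to norms
in `K`. -/
theorem exists_functional (c : A × H →₀ ℂ) : ∃ F : A →ₗ[ℂ] ℂ, ∀ d d',
    inner ℂ (Finsupp.linearCombination ℂ (fun p : A × H => e (d * p.1) p.2) c)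
      (Finsupp.linearCombination ℂ (fun p : A × H => e (d' * p.1) p.2) c) = F (star d * d') := by
  refine ⟨
    { toFun := fun b => c.sum fun i z => c.sum fun j w =>
        star z * w * inner ℂ i.2 (T (star i.1 * b * j.1) j.2)
      map_add' := fun b b' => by
        simp only [mul_add, add_mul, map_add, add_apply, inner_add_right, Finsupp.sum_add]
      map_smul' := fun r b => by
        simp only [mul_smul_comm, smul_mul_assoc, map_smul, smul_apply, inner_smul_right,
          Finsupp.mul_sum, smul_eq_mul, RingHom.id_apply, mul_left_comm] }, fun d d' => ?_⟩
  rw [inner_linearCombination]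
  simp only [he.inner_eq, star_mul, mul_assoc, LinearMap.coe_mk, AddHom.coe_mk]

variable [PartialOrder A] [StarOrderedRing A]

theorem tendsto_approximateUnit (a : A) (x : H) :
    Tendsto (fun u => e (u * a) x) (CStarAlgebra.approximateUnit A) (𝓝 (e a x)) :=
  ((he.continuous_apply x).tendsto a).comp
    ((CStarAlgebra.increasingApproximateUnit A).tendsto_mul_right a)

theorem tendsto_approximateUnit' (a : A) (x : H) :
    Tendsto (fun u => e (a * u) x) (CStarAlgebra.approximateUnit A) (𝓝 (e a x)) :=
  ((he.continuous_apply x).tendsto a).comp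
    ((CStarAlgebra.increasingApproximateUnit A).tendsto_mul_left a)

/-- Apply the functional to `u⋆ a⋆ a u ≤ ‖a‖² u⋆ u`. The factor `u` replaces the missing unit in `a⋆
a ≤ ‖a‖² 1`; it is removed afterwards along an approximate unit. -/
theorem norm_linearCombination_mul_le (a u : A) (c : A × H →₀ ℂ) :
    ‖Finsupp.linearCombination ℂ (fun p : A × H => e (a * u * p.1) p.2) c‖ ≤
      ‖a‖ * ‖Finsupp.linearCombination ℂ (fun p : A × H => e (u * p.1) p.2) c‖ := by
  obtain ⟨F, hF⟩ := he.exists_functional c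
  have hF' : ∀ d, ((‖Finsupp.linearCombination ℂ (fun p : A × H => e (d * p.1) p.2) c‖ ^ 2 : ℝ) : ℂ)
      = F (star d * d) := fun d => by
    rw [← hF, inner_self_eq_norm_sq_to_K]; simp
  have hle : star u * (star a * a) * u ≤ ‖star a * a‖ • (star u * u) :=
    CStarAlgebra.star_left_conjugate_le_norm_smul
  obtain ⟨g, hg⟩ := exists_eq_star_mul_self_of_nonneg (sub_nonneg.2 hle)
  have h1 : F (star g * g) = (‖a‖ * ‖a‖ : ℝ) * F (star u * u) - F (star (a * u) * (a * u)) := by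
    rw [← hg, map_sub, CStarRing.norm_star_mul_self, ← Complex.coe_smul, map_smul, star_mul]
    simp only [mul_assoc, smul_eq_mul]
  rw [← hF', ← hF', ← hF'] at h1
  norm_cast at h1
  refine le_of_sq_le_sq ?_ (by positivity)
  have := sq_nonneg ‖Finsupp.linearCombination ℂ (fun p : A × H => e (g * p.1) p.2) c‖
  rw [h1] at this
  nlinarith [this]

theorem norm_linearCombination_le (a : A) (c : A × H →₀ ℂ) :
    ‖Finsupp.linearCombination ℂ (fun p : A × H => e (a * p.1) p.2) c‖ ≤
      ‖a‖ * ‖Finsupp.linearCombination ℂ (fun p : A × H => e p.1 p.2) c‖ := by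
  have h2 : Tendsto (fun u => Finsupp.linearCombination ℂ (fun p : A × H => e (u * p.1) p.2) c)
      (CStarAlgebra.approximateUnit A)
      (𝓝 (Finsupp.linearCombination ℂ (fun p : A × H => e p.1 p.2) c)) :=
    tendsto_finsetSum _ fun p _ => (he.tendsto_approximateUnit p.1 p.2).const_smul _
  have h1 : Tendsto
      (fun u => Finsupp.linearCombination ℂ (fun p : A × H => e (a * u * p.1) p.2) c)
      (CStarAlgebra.approximateUnit A)
      (𝓝 (Finsupp.linearCombination ℂ (fun p : A × H => e (a * p.1) p.2) c)) := by
    refine tendsto_finsetSum _ fun p _ => Tendsto.const_smul ?_ _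
    refine ((he.continuous_apply p.2).tendsto (a * p.1)).comp ?_
    simp only [mul_assoc]
    exact ((CStarAlgebra.increasingApproximateUnit A).tendsto_mul_right p.1).const_mul a
  exact le_of_tendsto_of_tendsto' h1.norm (h2.norm.const_mul _)
    fun u => he.norm_linearCombination_mul_le a u c

variable [CompleteSpace K]

/-- The Stinespring representation. -/
theorem exists_rep : ∃ σ : A →⋆ₙₐ[ℂ] (K →L[ℂ] K), ∀ a b x, σ a (e b x) = e (a * b) x := by
  have h : ∀ a, ∃ U : K →L[ℂ] K, ∀ b x, U (e b x) = e (a * b) x := fun a => by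
    obtain ⟨U, hU, -⟩ := exists_continuousLinearMap_of_dense_span _
      (fun p : A × H => e (a * p.1) p.2) he.dense _ (he.norm_linearCombination_le a)
    exact ⟨U, fun b x => hU (b, x)⟩
  choose U hU using h
  refine ⟨
    { toFun := U
      map_smul' := fun r a => he.ext fun b x => by simp [hU, smul_mul_assoc]
      map_zero' := he.ext fun b x => by simp [hU]
      map_add' := fun a a' => he.ext fun b x => by simp [hU, add_mul]
      map_mul' := fun a a' => he.ext fun b x => by simp [hU, mul_assoc]
      map_star' := fun a => ?_ }, hU⟩
  rw [ContinuousLinearMap.star_eq_adjoint]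
  refine he.ext fun b x => he.eq_of_inner_eq fun b' x' => ?_
  rw [ContinuousLinearMap.adjoint_inner_left, hU, hU, he.inner_eq, he.inner_eq, star_mul,
    star_star, mul_assoc]

omit [CompleteSpace K] in
/-- The adjoint of the Stinespring isometry. -/
theorem exists_coisometry [CompleteSpace H] {C : ℝ} (hC0 : 0 ≤ C) (hC : ∀ a, ‖T a‖ ≤ C * ‖a‖) :
    ∃ R : K →L[ℂ] H, (∀ a x, R (e a x) = T a x) ∧ ∀ k, ‖R k‖ ≤ √C * ‖k‖ := by
  suffices h : ∀ c : A × H →₀ ℂ, ‖Finsupp.linearCombination ℂ (fun p : A × H => T p.1 p.2) c‖ ≤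
      √C * ‖Finsupp.linearCombination ℂ (fun p : A × H => e p.1 p.2) c‖ by
    obtain ⟨R, hR, hR'⟩ := exists_continuousLinearMap_of_dense_span _ _ he.dense _ h
    exact ⟨R, fun a x => hR (a, x), hR'⟩
  intro c
  set y := Finsupp.linearCombination ℂ (fun p : A × H => T p.1 p.2) c with hy
  set z := Finsupp.linearCombination ℂ (fun p : A × H => e p.1 p.2) c with hz
  -- For `u` in the approximate unit, `e u y` approximates `1 ⊗ y`. Thus `⟨e u y, z⟩ → ‖y‖²`, while
  -- `‖e u y‖² ≤ ‖T (u⋆ u)‖ ‖y‖² ≤ C ‖y‖²`; this yields `‖y‖² ≤ √C ‖y‖ ‖z‖`, with `√C` instead of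
  -- `C`.
  have hau := CStarAlgebra.increasingApproximateUnit A
  have h1 : ∀ u : A, star u = u → inner ℂ (e u y) z =
      inner ℂ y (Finsupp.linearCombination ℂ (fun p : A × H => T (u * p.1) p.2) c) := by
    intro u hu
    simp only [hz, Finsupp.linearCombination_apply, Finsupp.inner_sum, inner_smul_right,
      he.inner_eq, hu]
  have h2 : Tendsto (fun u => inner ℂ (e u y) z) (CStarAlgebra.approximateUnit A)
      (𝓝 (inner ℂ y y)) := by
    have h3 : Tendsto (fun u => inner ℂ y
        (Finsupp.linearCombination ℂ (fun p : A × H => T (u * p.1) p.2) c))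
        (CStarAlgebra.approximateUnit A) (𝓝 (inner ℂ y y)) := by
      refine tendsto_const_nhds.inner (tendsto_finsetSum _ fun p _ => Tendsto.const_smul ?_ _)
      exact ((T.continuous.clm_apply continuous_const).tendsto p.1).comp
        (hau.tendsto_mul_right p.1)
    refine h3.congr' ?_
    filter_upwards [hau.eventually_star_eq] with u hu using (h1 u hu).symm
  have h4 : ‖(inner ℂ y y : ℂ)‖ ≤ √C * ‖y‖ * ‖z‖ := by
    refine le_of_tendsto h2.norm ?_
    filter_upwards [hau.eventually_norm] with u hu
    refine (norm_inner_le_norm _ _).trans (mul_le_mul_of_nonneg_right ?_ (norm_nonneg _))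
    have h5 : ‖T (star u * u)‖ ≤ C := by
      have h6 : ‖star u * u‖ ≤ 1 := by
        rw [CStarRing.norm_star_mul_self]; exact mul_le_one₀ hu (norm_nonneg _) hu
      have h7 := hC (star u * u)
      nlinarith
    refine le_of_sq_le_sq ((he.norm_sq_le u y).trans ?_) (by positivity)
    rw [mul_pow, Real.sq_sqrt hC0]
    gcongr
  rw [inner_self_eq_norm_sq_to_K, norm_pow, RCLike.norm_ofReal, abs_norm] at h4
  by_cases hy0 : ‖y‖ = 0
  · rw [hy0]; positivity
  · have : 0 < ‖y‖ := lt_of_le_of_ne (norm_nonneg _) (Ne.symm hy0)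
    exact le_of_mul_le_mul_left (by linarith) this

end IsStinespring

end Stinespring

/-! ### Existence of the Stinespring space as a reproducing kernel Hilbert space. -/

section Existence

open ComplexOrder

variable {A B H : Type*} [NonUnitalCStarAlgebra A] [PartialOrder A] [StarOrderedRing A]
  [NonUnitalCStarAlgebra B] [PartialOrder B] [StarOrderedRing B]
  [NormedAddCommGroup H] [InnerProductSpace ℂ H] [CompleteSpace H]

theorem CompletelyPositiveMap.sum_inner_nonneg {n : Type*} [Fintype n] (φ : A →CP B)
    (π : B →⋆ₙₐ[ℂ] (H →L[ℂ] H)) (a : n → A) (x : n → H) :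
    0 ≤ ∑ i, ∑ j, inner ℂ (x i) (π (φ (star (a i) * a j)) (x j)) := by
  classical
  rcases isEmpty_or_nonempty n with hn | ⟨⟨k⟩⟩
  · simp
  -- The row `(a j)` padded with zero rows: `star N * N` has entries `star (a i) * a j`.
  · let N : CStarMatrix n n A := CStarMatrix.ofMatrix fun i j => if i = k then a j else 0
    have hk : ∀ j, N k j = a j := fun j => if_pos rfl
    have hl : ∀ l, l ≠ k → ∀ j, N l j = 0 := fun l h j => if_neg h
    have hN : ∀ i j, (star N * N) i j = star (a i) * a j := fun i j => by
      rw [CStarMatrix.mul_apply, Finset.sum_eq_single k]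
      · rw [CStarMatrix.star_apply, hk, hk]
      · intro l _ h
        rw [hl l h, mul_zero]
      · simp
    have h := CStarMatrix.sum_inner_nonneg π
      (φ.map_cstarMatrix_nonneg (star N * N) (star_mul_self_nonneg N)) x
    simpa only [CStarMatrix.map_apply, hN] using h

/-- The composition of a completely positive map with a representation. -/
noncomputable def CompletelyPositiveMap.compRep (φ : A →CP B) (π : B →⋆ₙₐ[ℂ] (H →L[ℂ] H)) :
    A →L[ℂ] (H →L[ℂ] H) :=
  ⟨(π : B →ₗ[ℂ] (H →L[ℂ] H)) ∘ₗ (φ : A →ₗ[ℂ] B), (map_continuous π).comp (map_continuous φ)⟩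

theorem CompletelyPositiveMap.compRep_apply (φ : A →CP B) (π : B →⋆ₙₐ[ℂ] (H →L[ℂ] H)) (a : A) :
    φ.compRep π a = π (φ a) := rfl

/-- The kernel `(a, b) ↦ π (φ (a⋆ b))`. -/
noncomputable def CompletelyPositiveMap.stinespringKernel (φ : A →CP B)
    (π : B →⋆ₙₐ[ℂ] (H →L[ℂ] H)) : Matrix A A (H →L[ℂ] H) :=
  Matrix.of fun a b => φ.compRep π (star a * b)

theorem CompletelyPositiveMap.map_star' (φ : A →CP B) (a : A) : φ (star a) = star (φ a) :=
  map_star φ a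

theorem CompletelyPositiveMap.posSemidef_stinespringKernel (φ : A →CP B)
    (π : B →⋆ₙₐ[ℂ] (H →L[ℂ] H)) : (φ.stinespringKernel π).PosSemidef := by
  have hH : (φ.stinespringKernel π).IsHermitian := by
    ext1 a b
    rw [Matrix.conjTranspose_apply, stinespringKernel, Matrix.of_apply, Matrix.of_apply,
      compRep_apply, compRep_apply, ← map_star, ← φ.map_star', star_mul, star_star]
  refine ((RKHS.posSemidef_tfae (K := φ.stinespringKernel π)).out 0 2 rfl rfl).2 ⟨hH, fun f => ?_⟩
  have h := φ.sum_inner_nonneg π (fun i : f.support => (i : A)) (fun i => f i)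
  -- The kernel criterion puts the operator on the left of the inner product; Hermitian symmetry
  -- moves it to the right.
  have h2 : (f.sum fun x w => f.sum fun x' w' => inner ℂ (φ.stinespringKernel π x' x w) w') =
      ∑ i : f.support, ∑ j : f.support,
        inner ℂ (f i) (π (φ (star (i : A) * j)) (f j)) := by
    simp only [Finsupp.sum]
    rw [← Finset.sum_coe_sort]
    refine Finset.sum_congr rfl fun i _ => ?_
    rw [← Finset.sum_coe_sort]
    refine Finset.sum_congr rfl fun j _ => ?_
    rw [← hH.apply, ContinuousLinearMap.star_eq_adjoint, ContinuousLinearMap.adjoint_inner_left]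
    rfl
  rw [h2]
  exact (Complex.le_def.1 h).1

/-- The reproducing vectors `RKHS.kerFun K a x` serve as `a ⊗ x`. Linearity in `a` is not built in:
it holds because these vectors are total and their inner products are linear in `b` through `T (star
a * b)`. -/
theorem CompletelyPositiveMap.exists_isStinespring (φ : A →CP B) (π : B →⋆ₙₐ[ℂ] (H →L[ℂ] H))
    [Fact (φ.stinespringKernel π).PosSemidef] :
    ∃ e : A →ₗ[ℂ] (H →L[ℂ] RKHS.OfKernel (φ.stinespringKernel π)),
      IsStinespring (φ.compRep π) e := by
  set K := RKHS.OfKernel (φ.stinespringKernel π) with hK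
  have h1 : ∀ a b x y, inner ℂ (RKHS.kerFun K a x) (RKHS.kerFun K b y) =
      inner ℂ x (φ.compRep π (star a * b) y) := by
    intro a b x y
    have h2 := RKHS.kernel_apply K a b
    rw [RKHS.OfKernel.kernel_ofKernel] at h2
    have h3 := congrArg (fun U : H →L[ℂ] H => inner ℂ x (U y)) h2
    simp only [ContinuousLinearMap.comp_apply, ContinuousLinearMap.adjoint_inner_right] at h3
    exact h3.symm
  have hd : Dense (Submodule.span ℂ {RKHS.kerFun K a x | (a : A) (x : H)} : Set K) :=
    Submodule.dense_iff_topologicalClosure_eq_top.2 (RKHS.kerFun_dense K)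
  have hext : ∀ k l : K, (∀ a x, inner ℂ (RKHS.kerFun K a x) k = inner ℂ (RKHS.kerFun K a x) l) →
      k = l := by
    intro k l h
    refine hd.eq_of_inner_right ℂ fun v hv => ?_
    induction hv using Submodule.span_induction with
    | mem v hv => obtain ⟨a, x, rfl⟩ := hv; exact h a x
    | zero => simp
    | add v w _ _ hv hw => rw [inner_add_left, inner_add_left, hv, hw]
    | smul c v _ hv => rw [inner_smul_left, inner_smul_left, hv]
  refine ⟨
    { toFun := RKHS.kerFun K
      map_add' := fun a b => ContinuousLinearMap.ext fun x => hext _ _ fun c y => by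
        rw [add_apply, inner_add_right, h1, h1, h1, mul_add, map_add, add_apply, inner_add_right]
      map_smul' := fun r a => ContinuousLinearMap.ext fun x => hext _ _ fun c y => by
        rw [smul_apply, inner_smul_right, h1, h1, mul_smul_comm, map_smul, smul_apply,
          inner_smul_right]; rfl }, h1, ?_⟩
  rw [← RKHS.kerFun_dense K]
  congr 2
  exact Set.ext fun k => ⟨fun ⟨p, hp⟩ => ⟨p.1, p.2, hp⟩, fun ⟨a, x, h⟩ => ⟨(a, x), h⟩⟩

end Existence

/-! ### Subspaces of the Stinespring space attached to intersections of ideals. -/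

section Intersection

open Filter Topology

variable {A H K : Type*} [NonUnitalCStarAlgebra A] [PartialOrder A] [StarOrderedRing A]
  [NormedAddCommGroup H] [InnerProductSpace ℂ H]
  [NormedAddCommGroup K] [InnerProductSpace ℂ K] [CompleteSpace K]
  {T : A →L[ℂ] (H →L[ℂ] H)} {e : A →ₗ[ℂ] (H →L[ℂ] K)}

/-- Each generator `e a x` with `a ∈ J` is the limit of `σ a (e u x)` along an approximate unit, so
`k` is orthogonal to the span containing it. -/
theorem IsStinespring.eq_zero_of_orthogonal (he : IsStinespring T e) {σ : A →⋆ₙₐ[ℂ] (K →L[ℂ] K)}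
    (hσ : ∀ a b x, σ a (e b x) = e (a * b) x) {J : Set A} {k : K}
    (hk : k ∈ stinespringSpan e J) (h : ∀ a ∈ J, σ (star a) k = 0) : k = 0 := by
  have h1 : ∀ a ∈ J, ∀ x, inner ℂ k (e a x) = 0 := by
    intro a ha x
    refine tendsto_nhds_unique (tendsto_const_nhds.inner (he.tendsto_approximateUnit' a x))
      (tendsto_const_nhds.congr fun u => ?_)
    rw [← hσ, ← ContinuousLinearMap.adjoint_inner_left, ← ContinuousLinearMap.star_eq_adjoint,
      ← map_star, h a ha, inner_zero_left]
  have h2 := apply_eq_of_mem_stinespringSpan e (innerSL ℂ k) 0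
    (fun a ha x => by simpa using h1 a ha x) hk
  simpa using h2

/-- Closed spans do not commute with intersections in general; the ideal structure is what helps.
Let `p` be the projection of `k` onto `P`. For `a ∈ I`, the operator `σ(a)` maps the span of `J`
into `P`, as `I J ⊆ I ∩ J`. Since `k - p ⟂ P`, this gives `‖σ(a⋆)(k - p)‖² = ⟨σ(a a⋆)(k - p), k - p⟩
= 0`, whence `k = p`. -/
theorem IsStinespring.mem_stinespringSpan_inter (he : IsStinespring T e)
    {σ : A →⋆ₙₐ[ℂ] (K →L[ℂ] K)} (hσ : ∀ a b x, σ a (e b x) = e (a * b) x)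
    {I J : NonUnitalStarSubalgebra ℂ A} (hI : ∀ a b : A, a ∈ I → a * b ∈ I)
    (hJ : ∀ a b : A, b ∈ J → a * b ∈ J) {k : K} (hkI : k ∈ stinespringSpan e I)
    (hkJ : k ∈ stinespringSpan e J) : k ∈ stinespringSpan e (I ∩ J : Set A) := by
  set P := stinespringSpan e (I ∩ J : Set A) with hP
  have : CompleteSpace P := (isClosed_stinespringSpan e _).completeSpace_coe
  have hPI : P ≤ stinespringSpan e I :=
    stinespringSpan_le e (isClosed_stinespringSpan e _)
      fun a ha x => mem_stinespringSpan e (J := (I : Set A)) ha.1 x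
  have hPJ : P ≤ stinespringSpan e J :=
    stinespringSpan_le e (isClosed_stinespringSpan e _)
      fun a ha x => mem_stinespringSpan e (J := (J : Set A)) ha.2 x
  set p : K := (P.orthogonalProjectionOnto k : K) with hp
  have hpP : p ∈ P := Subtype.property _
  have hJk : k - p ∈ stinespringSpan e (J : Set A) := Submodule.sub_mem _ hkJ (hPJ hpP)
  have hσP : ∀ a ∈ I, σ a (k - p) ∈ P := fun a ha =>
    apply_mem_of_mem_stinespringSpan e (σ a) (isClosed_stinespringSpan e _)
      (fun b hb x => by
        rw [hσ]; exact mem_stinespringSpan e (J := (I ∩ J : Set A)) ⟨hI _ _ ha, hJ _ _ hb⟩ x) hJk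
  have h0 : k - p = 0 := by
    refine he.eq_zero_of_orthogonal hσ (J := (I : Set A))
      (Submodule.sub_mem _ hkI (hPI hpP)) fun a ha => ?_
    rw [← inner_self_eq_zero (𝕜 := ℂ), map_star, ContinuousLinearMap.star_eq_adjoint,
      ContinuousLinearMap.adjoint_inner_left, ← ContinuousLinearMap.star_eq_adjoint, ← map_star,
      show σ a (σ (star a) (k - p)) = (σ a * σ (star a)) (k - p) from rfl, ← map_mul]
    have h2 := P.sub_starProjection_mem_orthogonal k
    exact Submodule.inner_left_of_mem_orthogonal (hσP _ (mul_mem ha (star_mem ha))) h2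
  rw [sub_eq_zero] at h0
  rw [h0]
  exact hpP

end Intersection

/-! ### Dilation of covariant maps to covariant representations. -/

section CovariantMap

variable {S : Type v} [InverseMonoid S] {A : Type u} [NonUnitalCStarAlgebra A]
  {α : PartialCStarAction S A} {H : Type w} [NormedAddCommGroup H] [InnerProductSpace ℂ H]
  [CompleteSpace H]

theorem PartialRep.op_one (V : PartialRep S H) (x : H) : V.op 1 x = x :=
  V.op_idem (by simp) x (by rw [V.dom_one]; trivial)

/-- A linear map `T : A → B(H)` covariant with respect to a partial representation on `H`. -/
structure IsCovariantMap (α : PartialCStarAction S A) (V : PartialRep S H)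
    (T : A →L[ℂ] (H →L[ℂ] H)) : Prop where
  map_act : ∀ s (a : α.dom (star s)), T (α.act s a) = V.op s * T a * V.op (star s)
  op_op_star : ∀ s, ∀ a ∈ α.dom s, V.op s * V.op (star s) * T a = T a
  mul_op_op_star : ∀ s, ∀ a ∈ α.dom s, T a * V.op s * V.op (star s) = T a
  op_star_op_mul : ∀ s t, ∀ d ∈ α.dom (star s), d ∈ α.dom t →
    T d * V.op (star s) * V.op (s * t) = T d * V.op t

/-- Each identity is the corresponding one for `π`, evaluated at `φ(a)`; equivariance places `φ(a)`
in the required ideal of `B`. -/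
theorem CovariantRep.isCovariantMap {B : Type*} [NonUnitalCStarAlgebra B]
    [PartialOrder A] [StarOrderedRing A] [PartialOrder B] [StarOrderedRing B]
    {β : PartialCStarAction S B} (ρ : CovariantRep β H) (φ : A →CP B)
    (hφ : PartialCStarAction.IsEquivariant α β φ.toLinearMap) :
    IsCovariantMap α ρ.v (φ.compRep ρ.π) where
  map_act s a := by
    rw [φ.compRep_apply, φ.compRep_apply]
    refine Eq.trans ?_ (ρ.covariant s ⟨φ a, hφ.mapsTo _ _ a.2⟩)
    exact congrArg ρ.π (hφ.map_act s a).symm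
  op_op_star s a ha := ρ.op_op_star_π s _ (hφ.mapsTo s a ha)
  mul_op_op_star s a ha := ρ.π_op_op_star s _ (hφ.mapsTo s a ha)
  op_star_op_mul s t d hs ht := ρ.π_op_star_op_mul s t _ (hφ.mapsTo _ d hs) (hφ.mapsTo t d ht)

variable {V : PartialRep S H} {K : Type*} [NormedAddCommGroup K] [InnerProductSpace ℂ K]
  {T : A →L[ℂ] (H →L[ℂ] H)} {e : A →ₗ[ℂ] (H →L[ℂ] K)}

theorem PartialCStarAction.coe_star_act_mul_act (α : PartialCStarAction S A) (s : S)
    (a b : α.dom (star s)) :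
    star (α.act s a : A) * (α.act s b : A) = α.act s (star a * b) := by
  rw [map_mul, map_star]; rfl

namespace IsCovariantMap

variable (hT : IsCovariantMap α V T) (he : IsStinespring T e)
include hT

theorem op_star_op (s : S) (a : A) (ha : a ∈ α.dom (star s)) :
    V.op (star s) * V.op s * T a = T a := by
  have := hT.op_op_star (star s) a ha
  rwa [starstar] at this

theorem mul_op_star_op (s : S) (a : A) (ha : a ∈ α.dom (star s)) :
    T a * V.op (star s) * V.op s = T a := by
  have := hT.mul_op_op_star (star s) a ha
  rwa [starstar] at this

include he

/-- Isometry of `w_s` on generators; it rests on `v_{s⋆} T(θ_s(a⋆ b)) v_s = T(a⋆ b)`. -/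
theorem inner_act (s : S) (a b : α.dom (star s)) (x y : H) :
    inner ℂ (e (α.act s a) (V.op s x)) (e (α.act s b) (V.op s y)) =
      inner ℂ (e a x) (e b y) := by
  have h1 := hT.op_star_op s _ (star a * b).2
  have h2 := hT.mul_op_star_op s _ (star a * b).2
  have h3 : V.op (star s) * T (α.act s (star a * b)) * V.op s = T (star a * b : α.dom (star s)) := by
    rw [hT.map_act]
    calc _ = V.op (star s) * V.op s * (T (star a * b : α.dom (star s)) * V.op (star s) * V.op s) := by
          simp only [mul_assoc]
      _ = _ := by rw [h2, h1]
  rw [he.inner_eq, he.inner_eq, α.coe_star_act_mul_act]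
  have h4 := V.inner_op (star s) x (T (α.act s (star a * b)) (V.op s y))
  rw [starstar] at h4
  rw [h4]
  exact congrArg (fun U : H →L[ℂ] H => inner ℂ x (U y)) h3

theorem apply_op_op_star (s : S) (a : A) (ha : a ∈ α.dom s) (x : H) :
    e a (V.op s (V.op (star s) x)) = e a x :=
  he.apply_eq_apply (congrArg (fun U : H →L[ℂ] H => U x)
    (hT.mul_op_op_star s (star a * a) (α.mul_mem_left _ _ _ ha)))

variable [CompleteSpace K]

/-- The partial isometries of the dilated partial representation. -/
theorem exists_op : ∃ W : S → (K →L[ℂ] K),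
    (∀ s (a : α.dom (star s)) x, W s (e a x) = e (α.act s a) (V.op s x)) ∧
    ∀ s, ∀ k ∈ stinespringSpan e (α.dom (star s)), ‖W s k‖ = ‖k‖ := by
  have h : ∀ s, ∃ U : K →L[ℂ] K,
      (∀ (a : α.dom (star s)) x, U (e a x) = e (α.act s a) (V.op s x)) ∧
      ∀ k ∈ stinespringSpan e (α.dom (star s)), ‖U k‖ = ‖k‖ := fun s => by
    obtain ⟨U, hU, hU'⟩ := exists_isometry_on_closure_span
      (fun p : α.dom (star s) × H => e p.1 p.2)
      (fun p : α.dom (star s) × H => e (α.act s p.1) (V.op s p.2))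
      fun p q => (hT.inner_act he s p.1 q.1 p.2 q.2).symm
    exact ⟨U, fun a x => hU (a, x), hU'⟩
  choose W h1 h2 using h
  exact ⟨W, h1, h2⟩

section Op

variable {W : S → (K →L[ℂ] K)}
  (hW : ∀ s (a : α.dom (star s)) x, W s (e a x) = e (α.act s a) (V.op s x))
include hW

omit hT he [CompleteSpace K] in
theorem op_mem (s : S) {k : K} (hk : k ∈ stinespringSpan e (α.dom (star s))) :
    W s k ∈ stinespringSpan e (α.dom s) :=
  apply_mem_of_mem_stinespringSpan e (W s) (isClosed_stinespringSpan e _)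
    (fun a ha x => by
      rw [hW s ⟨a, ha⟩]
      exact mem_stinespringSpan e (J := (α.dom s : Set A)) (α.act s _).2 _) hk

omit hT he [CompleteSpace K] in
theorem op_star_apply (s : S) (a : α.dom s) (x : H) :
    W (star s) (e a x) = e (α.actStar s a) (V.op (star s) x) :=
  hW (star s) ⟨a, by rw [starstar]; exact a.2⟩ x

omit [CompleteSpace K] in
theorem op_op_star_apply (s : S) {k : K} (hk : k ∈ stinespringSpan e (α.dom s)) :
    W s (W (star s) k) = k :=
  apply_eq_of_mem_stinespringSpan e (W s ∘L W (star s)) (ContinuousLinearMap.id ℂ K)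
    (fun a ha x => by
      rw [ContinuousLinearMap.comp_apply, op_star_apply hW s ⟨a, ha⟩, hW, α.act_actStar,
        hT.apply_op_op_star he s a ha]
      rfl) hk

omit [CompleteSpace K] in
theorem op_star_op_apply (s : S) {k : K} (hk : k ∈ stinespringSpan e (α.dom (star s))) :
    W (star s) (W s k) = k := by
  have := hT.op_op_star_apply he hW (star s) hk
  rwa [starstar] at this

/-- The vector `y = W s k` lies in `K_s ∩ K_{t⋆}`, hence in the closed span of `c ⊗ x` with `c ∈ A_s
∩ A_{t⋆}`. Writing `k = W (star s) y` reduces both claims to such generators. -/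
theorem op_mul [PartialOrder A] [StarOrderedRing A] {σ : A →⋆ₙₐ[ℂ] (K →L[ℂ] K)}
    (hσ : ∀ a b x, σ a (e b x) = e (a * b) x) (s t : S) {k : K}
    (hk : k ∈ stinespringSpan e (α.dom (star s)))
    (hk' : W s k ∈ stinespringSpan e (α.dom (star t))) :
    k ∈ stinespringSpan e (α.dom (star (t * s))) ∧ W (t * s) k = W t (W s k) := by
  have hy := he.mem_stinespringSpan_inter hσ (α.mul_mem_right s) (α.mul_mem_left (star t))
    (op_mem hW s hk) hk'
  have hdom : ∀ (c : A) (hs : c ∈ α.dom s), c ∈ α.dom (star t) →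
      (α.actStar s ⟨c, hs⟩ : A) ∈ α.dom (star (t * s)) := fun c hs ht => by
    rw [star_mul_rev]
    exact α.act_mem (star s) (star t) ⟨c, by rw [starstar]; exact hs⟩ ht
  rw [← hT.op_star_op_apply he hW s hk]
  set y := W s k
  rw [hT.op_op_star_apply he hW s (op_mem hW s hk)]
  constructor
  · refine apply_mem_of_mem_stinespringSpan e (W (star s)) (isClosed_stinespringSpan e _)
      (fun c hc x => ?_) hy
    rw [op_star_apply hW s ⟨c, hc.1⟩]
    exact mem_stinespringSpan e (J := (α.dom (star (t * s)) : Set A)) (hdom c hc.1 hc.2) _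
  · refine apply_eq_of_mem_stinespringSpan e (W (t * s) ∘L W (star s)) (W t)
      (fun c hc x => ?_) hy
    obtain ⟨hs, ht⟩ := hc
    have hcs : (α.act s (α.actStar s ⟨c, hs⟩) : A) = c := by rw [α.act_actStar]
    obtain ⟨h', hact⟩ := α.act_mul s t (α.actStar s ⟨c, hs⟩) (by rw [hcs]; exact ht)
    rw [ContinuousLinearMap.comp_apply, op_star_apply hW s ⟨c, hs⟩, hW (t * s) ⟨_, h'⟩, hact,
      hW t ⟨c, ht⟩]
    have h1 : (α.act t ⟨α.act s (α.actStar s ⟨c, hs⟩), by rw [hcs]; exact ht⟩ : A) =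
        α.act t ⟨c, ht⟩ := by
      congr 2; exact Subtype.ext hcs
    rw [h1]
    -- The first tensor factors now agree; the second ones are `v_{ts} v_{s⋆} x` and `v_t x`. They
    -- need only agree after applying `T(θ_t(c⋆ c)) = v_t T(c⋆ c) v_{t⋆}`.
    refine he.apply_eq_apply ?_
    rw [α.coe_star_act_mul_act, hT.map_act]
    set d : α.dom (star t) := star ⟨c, ht⟩ * ⟨c, ht⟩ with hd
    have hds : (d : A) ∈ α.dom s := α.mul_mem_left _ _ _ hs
    have h2 := hT.op_star_op_mul t s d d.2 hds
    have h3 := hT.mul_op_op_star s d hds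
    have h4 := hT.mul_op_star_op t d d.2
    have h5 : V.op t * T d * V.op (star t) * V.op (t * s) * V.op (star s) =
        V.op t * T d * V.op (star t) * V.op t := by
      calc _ = V.op t * (T d * V.op (star t) * V.op (t * s)) * V.op (star s) := by
            simp only [mul_assoc]
        _ = V.op t * (T d * V.op s * V.op (star s)) := by rw [h2]; simp only [mul_assoc]
        _ = V.op t * (T d * V.op (star t) * V.op t) := by rw [h3, h4]
        _ = _ := by simp only [mul_assoc]
    exact congrArg (fun U : H →L[ℂ] H => U x) h5

end Op

theorem exists_partialRep [PartialOrder A] [StarOrderedRing A] {σ : A →⋆ₙₐ[ℂ] (K →L[ℂ] K)}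
    (hσ : ∀ a b x, σ a (e b x) = e (a * b) x) :
    ∃ W : PartialRep S K, (∀ s, W.dom s = stinespringSpan e (α.dom s)) ∧
      ∀ s (a : α.dom (star s)) x, W.op s (e a x) = e (α.act s a) (V.op s x) := by
  obtain ⟨W, hW, hWn⟩ := hT.exists_op he
  have hdom1 : stinespringSpan e (α.dom 1 : Set A) = ⊤ := by
    rw [α.dom_one]; exact he.stinespringSpan_univ
  let R : PartialRep S K :=
    { dom := fun s => stinespringSpan e (α.dom s)
      isClosed_dom := fun s => isClosed_stinespringSpan e _
      act := fun s =>
        { toFun := fun k => ⟨W s k, op_mem hW s k.2⟩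
          invFun := fun k => ⟨W (star s) k, op_mem hW (star s) (by rw [starstar]; exact k.2)⟩
          map_add' := fun k l => Subtype.ext (map_add (W s) (k : K) l)
          map_smul' := fun c k => Subtype.ext (map_smul (W s) c (k : K))
          left_inv := fun k => Subtype.ext (hT.op_star_op_apply he hW s k.2)
          right_inv := fun k => Subtype.ext (hT.op_op_star_apply he hW s k.2)
          norm_map' := fun k => hWn s k k.2 }
      dom_one := hdom1
      act_one := fun k => by
        refine apply_eq_of_mem_stinespringSpan e (W 1) (ContinuousLinearMap.id ℂ K)
          (fun a ha x => ?_) k.2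
        rw [hW 1 ⟨a, ha⟩, α.act_one, V.op_one]
        rfl
      act_mul := fun s t k h =>
        have h2 := hT.op_mul he hW hσ s t k.2 h
        ⟨h2.1, h2.2⟩ }
  refine ⟨R, fun s => rfl, fun s a x => ?_⟩
  have hm : e a x ∈ R.dom (star s) := mem_stinespringSpan e (J := (α.dom (star s) : Set A)) a.2 x
  rw [R.op_apply_of_mem s _ hm]
  exact hW s a x

/-- The covariant representation on the Stinespring space of a covariant map. -/
theorem exists_covariantRep [PartialOrder A] [StarOrderedRing A] :
    ∃ ρ : CovariantRep α K, (∀ a b x, ρ.π a (e b x) = e (a * b) x) ∧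
      ∀ s (a : α.dom (star s)) x, ρ.v.op s (e a x) = e (α.act s a) (V.op s x) := by
  obtain ⟨σ, hσ⟩ := he.exists_rep
  obtain ⟨W, hdom, hW⟩ := hT.exists_partialRep he hσ
  have hmem : ∀ s, ∀ a ∈ α.dom s, ∀ k, σ a k ∈ W.dom s := fun s a ha k => by
    rw [hdom]
    refine apply_mem_of_mem_stinespringSpan e (J := Set.univ) (σ a)
      (isClosed_stinespringSpan e _) (fun b _ x => ?_)
      (he.stinespringSpan_univ ▸ Submodule.mem_top)
    rw [hσ]
    exact mem_stinespringSpan e (J := (α.dom s : Set A)) (α.mul_mem_right _ _ _ ha) x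
  refine ⟨⟨σ, W, fun s => le_antisymm ?_ ?_, fun s a => ?_⟩, hσ, hW⟩
  · refine Submodule.topologicalClosure_minimal _ (Submodule.span_le.2 ?_) (W.isClosed_dom s)
    rintro _ ⟨a, ha, k, rfl⟩
    exact hmem s a ha k
  · rw [hdom]
    -- Nondegeneracy: `e a x` is the limit of `σ a (e u x)` along an approximate unit.
    refine stinespringSpan_le e (Submodule.isClosed_topologicalClosure _) fun a ha x => ?_
    refine (Submodule.isClosed_topologicalClosure _).mem_of_tendsto
      (he.tendsto_approximateUnit' a x) (Filter.Eventually.of_forall fun u => ?_)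
    exact Submodule.le_topologicalClosure _ (Submodule.subset_span ⟨a, ha, e u x, hσ a u x⟩)
  · ext k
    -- Both sides of the covariance identity vanish on the complement of `K_s`, so it suffices to
    -- compare them at the projection of `k`, and then on generators of `K_s`.
    set p : K := ((W.dom s).orthogonalProjectionOnto k : K) with hp
    have hpm : p ∈ stinespringSpan e (α.dom s) := hdom s ▸ Subtype.property _
    have h1 : σ (α.act s a) k = σ (α.act s a) p := by
      rw [← sub_eq_zero, ← map_sub]
      refine ext_inner_right ℂ fun l => ?_
      rw [inner_zero_left, ← ContinuousLinearMap.adjoint_inner_right,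
        ← ContinuousLinearMap.star_eq_adjoint, ← map_star]
      exact Submodule.inner_left_of_mem_orthogonal
        (hmem s _ (star_mem (α.act s a).2) l) ((W.dom s).sub_starProjection_mem_orthogonal k)
    have h2 : W.op (star s) k = W.op (star s) p := by
      have h3 := W.op_op_star_eq_proj s k
      rw [hp, ← h3]
      exact (W.op_star_op s _ (W.op_mem _ k)).symm
    have h4 : ∀ k ∈ stinespringSpan e (α.dom s), σ (α.act s a) k =
        (W.op s * σ a * W.op (star s)) k := fun k hk => by
      refine apply_eq_of_mem_stinespringSpan e _ _ (fun c hc x => ?_) hk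
      change _ = W.op s (σ a (W.op (star s) (e c x)))
      have h5 : W.op (star s) (e c x) = e (α.actStar s ⟨c, hc⟩) (V.op (star s) x) :=
        op_star_apply hW s ⟨c, hc⟩ x
      rw [h5, hσ, hσ]
      have h6 := hW s (a * α.actStar s ⟨c, hc⟩) (V.op (star s) x)
      rw [map_mul, α.act_actStar] at h6
      refine Eq.trans ?_ h6.symm
      exact (hT.apply_op_op_star he s _ (α.mul_mem_left _ _ _ hc) x).symm
    rw [h1, h4 p hpm]
    exact congrArg (fun l => W.op s (σ a l)) h2.symm

/-- With `R⋆ y` read as `1 ⊗ y`, this is `σ(a) w_s (1 ⊗ y) = a ⊗ v_s y`. Pairing with the generators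
`e b x` makes sense of it without a unit. -/
theorem rep_op_adjoint {ρ : CovariantRep α K} (hπ : ∀ a b x, ρ.π a (e b x) = e (a * b) x)
    (hv : ∀ s (a : α.dom (star s)) x, ρ.v.op s (e a x) = e (α.act s a) (V.op s x))
    {R : K →L[ℂ] H} (hR : ∀ a x, R (e a x) = T a x) (s : S) (a : α.dom s) (y : H) :
    (ρ.π a * ρ.v.op s) (ContinuousLinearMap.adjoint R y) = e a (V.op s y) := by
  refine he.eq_of_inner_eq fun b x => ?_
  have h1 : star (ρ.π a * ρ.v.op s) = ρ.v.op (star s) * ρ.π (star (a : A)) := by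
    rw [star_mul, ρ.v.star_op, map_star]
  have hm : star (a : A) * b ∈ α.dom s := α.mul_mem_right _ _ _ (star_mem a.2)
  have hm' : star (a : A) * b ∈ α.dom (star (star s)) := by rwa [starstar]
  have h2 := hv (star s) ⟨_, hm'⟩ x
  have h3 : T (α.act (star s) ⟨_, hm'⟩) = V.op (star s) * T (star (a : A) * b) * V.op s := by
    exact (hT.map_act (star s) ⟨_, hm'⟩).trans
      (congrArg (fun t => V.op (star s) * T (star (a : A) * b) * V.op t) (starstar s))
  have h4 := hT.mul_op_op_star s _ hm
  -- Covariance leaves a factor `v_s v_{s⋆}` on the right, which `T(a⋆ b)` absorbs because `a⋆ b ∈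
  -- A_s`.
  have h5 : T (α.act (star s) ⟨_, hm'⟩) * V.op (star s) =
      V.op (star s) * T (star (a : A) * b) := by
    rw [h3]
    simp only [mul_assoc] at h4 ⊢
    rw [h4]
  rw [← ContinuousLinearMap.adjoint_inner_right, ← ContinuousLinearMap.star_eq_adjoint, h1,
    ContinuousLinearMap.adjoint_inner_left, he.inner_eq]
  change inner ℂ y (R (ρ.v.op (star s) (ρ.π (star (a : A)) (e b x)))) = _
  rw [hπ, h2, hR]
  refine (congrArg (fun U : H →L[ℂ] H => inner ℂ y (U x)) h5).trans ?_
  change inner ℂ y (V.op (star s) _) = _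
  have h6 := V.inner_op (star s) y (T (star (a : A) * b) x)
  rw [starstar] at h6
  exact h6.symm

/-- A covariant map is the compression of its dilation. -/
theorem comp_integrated_single_comp_adjoint {ρ : CovariantRep α K}
    (hπ : ∀ a b x, ρ.π a (e b x) = e (a * b) x)
    (hv : ∀ s (a : α.dom (star s)) x, ρ.v.op s (e a x) = e (α.act s a) (V.op s x))
    {R : K →L[ℂ] H} (hR : ∀ a x, R (e a x) = T a x) (s : S) (a : α.dom s) :
    R ∘L ρ.integrated (PartialCStarAction.Cc.single α s a) ∘L ContinuousLinearMap.adjoint R =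
      T a * V.op s := by
  ext y
  rw [ContinuousLinearMap.comp_apply, ContinuousLinearMap.comp_apply,
    CovariantRep.integrated_single, hT.rep_op_adjoint he hπ hv hR, hR]
  rfl

end IsCovariantMap

end CovariantMap

/-! ### Positivity of compressed matrices. -/

section Compression

open ComplexOrder

theorem inner_comp_star_mul_comp_adjoint {E F : Type*} [NormedAddCommGroup E]
    [InnerProductSpace ℂ E] [CompleteSpace E] [NormedAddCommGroup F] [InnerProductSpace ℂ F]
    [CompleteSpace F] (R : E →L[ℂ] F) (U V : E →L[ℂ] E) (x y : F) :
    inner ℂ x ((R ∘L (star U * V) ∘L ContinuousLinearMap.adjoint R) y) =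
      inner ℂ (U (ContinuousLinearMap.adjoint R x)) (V (ContinuousLinearMap.adjoint R y)) := by
  rw [ContinuousLinearMap.comp_apply, ← ContinuousLinearMap.adjoint_inner_left,
    ← ContinuousLinearMap.adjoint_inner_right U, ← ContinuousLinearMap.star_eq_adjoint U]
  rfl

/-- The form equals `∑_l ‖∑_i U_{li} R⋆ x_i‖²`. -/
theorem sum_inner_comp_star_mul_comp_adjoint_nonneg {n E F : Type*} [Fintype n]
    [NormedAddCommGroup E]
    [InnerProductSpace ℂ E] [CompleteSpace E] [NormedAddCommGroup F] [InnerProductSpace ℂ F]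
    [CompleteSpace F] (R : E →L[ℂ] F) (U : n → n → E →L[ℂ] E) (x : n → F) :
    0 ≤ ∑ i, ∑ j, inner ℂ (x i)
      ((R ∘L (∑ l, star (U l i) * U l j) ∘L ContinuousLinearMap.adjoint R) (x j)) := by
  have h1 : ∀ i j, inner ℂ (x i)
      ((R ∘L (∑ l, star (U l i) * U l j) ∘L ContinuousLinearMap.adjoint R) (x j)) =
      ∑ l, inner ℂ (U l i (ContinuousLinearMap.adjoint R (x i)))
        (U l j (ContinuousLinearMap.adjoint R (x j))) := by
    intro i j
    simp only [← inner_comp_star_mul_comp_adjoint]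
    rw [ContinuousLinearMap.comp_apply, ContinuousLinearMap.comp_apply, sum_apply, map_sum,
      inner_sum]
    rfl
  have h2 : ∑ i, ∑ j, inner ℂ (x i)
      ((R ∘L (∑ l, star (U l i) * U l j) ∘L ContinuousLinearMap.adjoint R) (x j)) =
      ∑ l, inner ℂ (∑ i, U l i (ContinuousLinearMap.adjoint R (x i)))
        (∑ i, U l i (ContinuousLinearMap.adjoint R (x i))) := by
    simp only [h1, sum_inner, inner_sum]
    calc _ = ∑ i, ∑ l, ∑ j, inner ℂ (U l i (ContinuousLinearMap.adjoint R (x i)))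
          (U l j (ContinuousLinearMap.adjoint R (x j))) :=
          Finset.sum_congr rfl fun i _ => Finset.sum_comm
      _ = _ := Finset.sum_comm
      _ = _ := Finset.sum_congr rfl fun l _ => Finset.sum_comm
  rw [h2]
  exact sum_inner_self_nonneg _

end Compression

/-! ### Compression formula, norm estimate and representations of the crossed product. -/

section Main

variable {S : Type v} [InverseMonoid S]

section Dilation

variable {A B : Type u} [NonUnitalCStarAlgebra A] [PartialOrder A] [StarOrderedRing A]
  [NonUnitalCStarAlgebra B] [PartialOrder B] [StarOrderedRing B]
  {α : PartialCStarAction S A} {β : PartialCStarAction S B}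

/-- Every covariant representation of `(B, S, β)`, composed with an equivariant completely positive
map `φ : A → B`, is a compression of a covariant representation of `(A, S, α)`. -/
theorem PartialCStarAction.IsEquivariant.exists_dilation (φ : A →CP B)
    (hφ : PartialCStarAction.IsEquivariant α β φ.toLinearMap) (ρ : SomeCovariantRep β) {C : ℝ}
    (hC0 : 0 ≤ C) (hC : ∀ a, ‖φ a‖ ≤ C * ‖a‖) :
    ∃ (ρ' : SomeCovariantRep α) (R : ρ'.H →L[ℂ] ρ.H), (∀ k, ‖R k‖ ≤ √C * ‖k‖) ∧
      ∀ f : α.Cc, ρ.rep.integrated (hφ.mapCc f) =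
        R ∘L ρ'.rep.integrated f ∘L ContinuousLinearMap.adjoint R := by
  have hpos : Fact (φ.stinespringKernel ρ.rep.π).PosSemidef :=
    ⟨φ.posSemidef_stinespringKernel ρ.rep.π⟩
  obtain ⟨e, he⟩ := φ.exists_isStinespring ρ.rep.π
  have hT := ρ.rep.isCovariantMap φ hφ
  obtain ⟨ρ', hπ, hv⟩ := hT.exists_covariantRep he
  obtain ⟨R, hR, hRn⟩ := he.exists_coisometry hC0 fun a =>
    (NonUnitalStarAlgHom.norm_apply_le ρ.rep.π (φ a)).trans (hC a)
  -- The dilation space is built from `A : Type u` and `ρ.H : Type (max u v)`, so it stays in the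
  -- universe allowed by `SomeCovariantRep α`.
  refine ⟨⟨_, ρ'⟩, R, hRn, fun f => ?_⟩
  induction f using PartialCStarAction.Cc.induction with
  | zero => simp
  | add f g hf hg =>
    rw [map_add, map_add, hf, hg, map_add, ContinuousLinearMap.add_comp,
      ContinuousLinearMap.comp_add]
  | single s a =>
    rw [PartialCStarAction.IsEquivariant.mapCc_single, CovariantRep.integrated_single]
    exact (hT.comp_integrated_single_comp_adjoint he hπ hv hR s a).symm

/-- The compression formula bounds each representation by `‖R‖² ‖f‖ ≤ C ‖f‖`. -/
theorem PartialCStarAction.IsEquivariant.norm_mapCc_le (φ : A →CP B)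
    (hφ : PartialCStarAction.IsEquivariant α β φ.toLinearMap) {C : ℝ} (hC0 : 0 ≤ C)
    (hC : ∀ a, ‖φ a‖ ≤ C * ‖a‖) (f : α.Cc) : ‖hφ.mapCc f‖ ≤ C * ‖f‖ := by
  refine PartialCStarAction.Cc.norm_le_of_forall (by positivity) fun ρ => ?_
  obtain ⟨ρ', R, hR, h⟩ := hφ.exists_dilation φ ρ hC0 hC
  rw [h]
  have h1 : ‖R‖ ≤ √C := R.opNorm_le_bound (by positivity) hR
  have h2 := PartialCStarAction.Cc.norm_integrated_le ρ' f
  calc _ ≤ ‖R‖ * (‖ρ'.rep.integrated f‖ * ‖ContinuousLinearMap.adjoint R‖) :=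
        (ContinuousLinearMap.opNorm_comp_le _ _).trans
          (mul_le_mul_of_nonneg_left (ContinuousLinearMap.opNorm_comp_le _ _) (norm_nonneg _))
    _ ≤ √C * (‖f‖ * √C) := by
        rw [LinearIsometryEquiv.norm_map]
        gcongr
    _ = (√C * √C) * ‖f‖ := by ring
    _ = _ := by rw [Real.mul_self_sqrt hC0]

end Dilation

namespace PartialCStarAction.CrossedProduct

variable {A : Type u} [NonUnitalCStarAlgebra A] {α : PartialCStarAction S A}

/-- The representation of the crossed product given by a covariant representation. -/
theorem exists_rep (ρ : SomeCovariantRep α) :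
    ∃ σ : α.CrossedProduct →⋆ₙₐ[ℂ] (ρ.H →L[ℂ] ρ.H), ∀ f, σ (of α f) = ρ.rep.integrated f := by
  let I : α.Cc →L[ℂ] (ρ.H →L[ℂ] ρ.H) := ρ.rep.integrated.mkContinuous 1 fun f => by
    rw [one_mul]; exact Cc.norm_integrated_le ρ f
  have hI : ∀ f, I.extend (of α) (of α f) = ρ.rep.integrated f :=
    I.extend_eq denseRange_of isUniformInducing_of
  refine ⟨
    { toFun := I.extend (of α)
      map_smul' := fun c x => map_smul _ c x
      map_zero' := map_zero _
      map_add' := fun x y => map_add _ x y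
      map_mul' := fun x y => ?_
      map_star' := fun x => ?_ }, hI⟩
  · change I.extend (of α) (x * y) = I.extend (of α) x * I.extend (of α) y
    induction x using CrossedProduct.induction with
    | hp => exact isClosed_eq (by fun_prop) (by fun_prop)
    | h f =>
      induction y using CrossedProduct.induction with
      | hp => exact isClosed_eq (by fun_prop) (by fun_prop)
      | h g => rw [← of_mul, hI, hI, hI, ρ.rep.integrated_mul]
  · change I.extend (of α) (star x) = star (I.extend (of α) x)
    induction x using CrossedProduct.induction with
    | hp =>
      exact isClosed_eq (f := fun x => I.extend (of α) (star x))
        ((I.extend (of α)).continuous.comp continuous_star')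
        (continuous_star.comp (I.extend (of α)).continuous)
    | h f => rw [← of_star, hI, hI, ρ.rep.integrated_star]

/-- Choose `f` within `‖x‖ / 2` of `x`. If every `σ ρ` kills `x`, then `‖σ ρ f‖ ≤ ‖x - f‖` for all
`ρ`, so `‖f‖ ≤ ‖x - f‖` and `‖x‖ < ‖x‖`. -/
theorem eq_zero_of_forall {σ : ∀ ρ : SomeCovariantRep α, α.CrossedProduct →⋆ₙₐ[ℂ] (ρ.H →L[ℂ] ρ.H)}
    (hσ : ∀ ρ f, σ ρ (of α f) = ρ.rep.integrated f) (x : α.CrossedProduct)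
    (h : ∀ ρ, σ ρ x = 0) : x = 0 := by
  by_contra hx
  have hpos : 0 < ‖x‖ / 2 := by positivity
  obtain ⟨f, hf⟩ := denseRange_of.exists_dist_lt x hpos
  rw [dist_eq_norm] at hf
  have h1 : ‖of α f‖ ≤ ‖x - of α f‖ := by
    rw [norm_of]
    refine Cc.norm_le_of_forall (norm_nonneg _) fun ρ => ?_
    have h2 := NonUnitalStarAlgHom.norm_apply_le (σ ρ) (x - of α f)
    rwa [map_sub, h, zero_sub, norm_neg, hσ] at h2
  have h3 := norm_add_le (x - of α f) (of α f)
  rw [sub_add_cancel] at h3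
  linarith

end PartialCStarAction.CrossedProduct

end Main

/-! ### Complete positivity of the extension. -/

section MainTheorem

open PartialCStarAction ComplexOrder

variable {S : Type v} [InverseMonoid S] {A B : Type u}
    [NonUnitalCStarAlgebra A] [PartialOrder A] [StarOrderedRing A]
    [NonUnitalCStarAlgebra B] [PartialOrder B] [StarOrderedRing B]
    {α : PartialCStarAction S A} {β : PartialCStarAction S B}

theorem CompletelyPositiveMap.exists_norm_le (φ : A →CP B) :
    ∃ C : ℝ, 0 ≤ C ∧ ∀ a, ‖φ a‖ ≤ C * ‖a‖ := by
  obtain ⟨C, hC⟩ := PositiveLinearMap.exists_norm_apply_le (.ofClass φ : A →ₚ[ℂ] B)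
  exact ⟨C, C.2, hC⟩

theorem PartialCStarAction.IsEquivariant.integrated_mapCc_star_mul (φ : A →CP B)
    (hφ : IsEquivariant α β φ.toLinearMap) (ρ : SomeCovariantRep β) {n : Type*} [Fintype n]
    (f : n → n → α.Cc) (x : n → ρ.H) :
    0 ≤ ∑ i, ∑ j, inner ℂ (x i)
      (ρ.rep.integrated (hφ.mapCc (∑ l, star (f l i) * f l j)) (x j)) := by
  obtain ⟨C, hC0, hC⟩ := φ.exists_norm_le
  obtain ⟨ρ', R, -, h⟩ := hφ.exists_dilation φ ρ hC0 hC
  have h' : ∀ i j, ρ.rep.integrated (hφ.mapCc (∑ l, star (f l i) * f l j)) =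
      R ∘L (∑ l, star (ρ'.rep.integrated (f l i)) * ρ'.rep.integrated (f l j)) ∘L
        ContinuousLinearMap.adjoint R := fun i j => by
    rw [h, map_sum]
    simp only [CovariantRep.integrated_mul, CovariantRep.integrated_star]
  simp only [h']
  exact sum_inner_comp_star_mul_comp_adjoint_nonneg R (fun i j => ρ'.rep.integrated (f i j)) x

/-- Compressions `X ↦ R X R⋆` commute with adjoints. The identity is needed because the positivity
test applies to selfadjoint matrices only. -/
theorem PartialCStarAction.IsEquivariant.mapCc_star (φ : A →CP B)
    (hφ : IsEquivariant α β φ.toLinearMap) (f : α.Cc) :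
    CrossedProduct.of β (hφ.mapCc (star f)) = star (CrossedProduct.of β (hφ.mapCc f)) := by
  obtain ⟨C, hC0, hC⟩ := φ.exists_norm_le
  rw [← CrossedProduct.of_star]
  refine CrossedProduct.of_eq_of fun ρ => ?_
  obtain ⟨ρ', R, -, h⟩ := hφ.exists_dilation φ ρ hC0 hC
  rw [h, CovariantRep.integrated_star, CovariantRep.integrated_star, h,
    ContinuousLinearMap.star_eq_adjoint, ContinuousLinearMap.star_eq_adjoint,
    ContinuousLinearMap.adjoint_comp, ContinuousLinearMap.adjoint_comp,
    ContinuousLinearMap.adjoint_adjoint]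
  rfl

theorem PartialCStarAction.IsEquivariant.map_star_mul_self_nonneg (φ : A →CP B)
    (hφ : IsEquivariant α β φ.toLinearMap) {Φ : α.CrossedProduct →L[ℂ] β.CrossedProduct}
    (hΦ : ∀ f, Φ (CrossedProduct.of α f) = CrossedProduct.of β (hφ.mapCc f)) {n : Type*} [Fintype n]
    (N : CStarMatrix n n α.CrossedProduct) : 0 ≤ (star N * N).map Φ := by
  -- The positive cone is closed and `N ↦ (star N * N).map Φ` is continuous, so it suffices to treat
  -- `N` with entries from `C_c(S, A)`, where the compression formula is available.
  have hcl : IsClosed {N : n → n → α.CrossedProduct |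
      0 ≤ ((star (CStarMatrix.ofMatrix (Matrix.of N)) * CStarMatrix.ofMatrix (Matrix.of N)).map Φ :
        CStarMatrix n n β.CrossedProduct)} := by
    have hc : Continuous fun N : n → n → α.CrossedProduct =>
        ((star (CStarMatrix.ofMatrix (Matrix.of N)) * CStarMatrix.ofMatrix (Matrix.of N)).map Φ :
          CStarMatrix n n β.CrossedProduct) := by
      refine continuous_pi fun i => continuous_pi fun j => ?_
      refine Φ.continuous.comp ?_
      simp only [CStarMatrix.mul_apply, CStarMatrix.star_apply]
      refine continuous_finsetSum _ fun l _ => ?_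
      have h : ∀ k, Continuous fun N : n → n → α.CrossedProduct => N l k := fun k => by fun_prop
      exact (CrossedProduct.continuous_star'.comp (h i)).mul (h j)
    exact CStarAlgebra.isClosed_nonneg.preimage hc
  have hs : ∀ x, Φ (star x) = star (Φ x) := fun x => by
    induction x using CrossedProduct.induction with
    | hp =>
      exact isClosed_eq (f := fun x => Φ (star x))
        (Φ.continuous.comp CrossedProduct.continuous_star')
        (CrossedProduct.continuous_star'.comp Φ.continuous)
    | h f => rw [← CrossedProduct.of_star, hΦ, hΦ, hφ.mapCc_star φ]
  have hd : DenseRange fun (f : n → n → α.Cc) i j => CrossedProduct.of α (f i j) :=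
    DenseRange.piMap fun _ => DenseRange.piMap fun _ => CrossedProduct.denseRange_of
  refine isClosed_property hd hcl (fun f => ?_) N
  choose σ hσ using fun ρ : SomeCovariantRep β => CrossedProduct.exists_rep ρ
  have hent : ∀ i j, ((star (CStarMatrix.ofMatrix (Matrix.of fun i j => CrossedProduct.of α (f i j)))
      * CStarMatrix.ofMatrix (Matrix.of fun i j => CrossedProduct.of α (f i j))).map Φ :
        CStarMatrix n n β.CrossedProduct) i j =
      CrossedProduct.of β (hφ.mapCc (∑ l, star (f l i) * f l j)) := by
    intro i j
    rw [← hΦ, map_sum]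
    simp only [CStarMatrix.map_apply, CStarMatrix.mul_apply, CStarMatrix.star_apply,
      CrossedProduct.of_mul, CrossedProduct.of_star]
    rfl
  refine CStarMatrix.nonneg_of_forall_sum_inner_nonneg σ (CrossedProduct.eq_zero_of_forall hσ)
    ?_ fun ρ x => ?_
  · refine CStarMatrix.ext fun i j => ?_
    rw [CStarMatrix.star_apply, CStarMatrix.map_apply, CStarMatrix.map_apply, ← hs,
      ← CStarMatrix.star_apply, star_mul, star_star]
  · simp only [hent, hσ]
    exact hφ.integrated_mapCc_star_mul φ ρ f x

end MainTheorem

theorem mainTheorem5 {S : Type v} [InverseMonoid S] {A B : Type u}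
    [NonUnitalCStarAlgebra A] [PartialOrder A] [StarOrderedRing A]
    [NonUnitalCStarAlgebra B] [PartialOrder B] [StarOrderedRing B]
    (α : PartialCStarAction S A) (β : PartialCStarAction S B)
    (φ : A →CP B) (hφ : PartialCStarAction.IsEquivariant α β φ.toLinearMap) :
    ∃ Φ : α.CrossedProduct →CP β.CrossedProduct,
      (∀ f : α.Cc, Φ (PartialCStarAction.CrossedProduct.of α f) =
        PartialCStarAction.CrossedProduct.of β (hφ.mapCc f)) ∧
      ((∀ a : A, ‖φ a‖ ≤ ‖a‖) → ∀ x : α.CrossedProduct, ‖Φ x‖ ≤ ‖x‖) := by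
  obtain ⟨C, hC0, hC⟩ := φ.exists_norm_le
  let F : α.Cc →L[ℂ] β.Cc := hφ.mapCc.mkContinuous C (hφ.norm_mapCc_le φ hC0 hC)
  let Φ : α.CrossedProduct →L[ℂ] β.CrossedProduct :=
    ((PartialCStarAction.CrossedProduct.of β).comp F).extend (PartialCStarAction.CrossedProduct.of α)
  have hΦ : ∀ f, Φ (PartialCStarAction.CrossedProduct.of α f) =
      PartialCStarAction.CrossedProduct.of β (hφ.mapCc f) :=
    ContinuousLinearMap.extend_eq _ PartialCStarAction.CrossedProduct.denseRange_of
      PartialCStarAction.CrossedProduct.isUniformInducing_of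
  refine ⟨⟨Φ.toLinearMap, fun k M hM => ?_⟩, hΦ, fun h x => ?_⟩
  -- Matrices over `A ⋊ S` again form a C⋆-algebra, so a nonnegative matrix has the form `star N *
  -- N`.
  · obtain ⟨N, rfl⟩ := exists_eq_star_mul_self_of_nonneg hM
    exact hφ.map_star_mul_self_nonneg φ hΦ N
  · change ‖Φ x‖ ≤ ‖x‖
    induction x using PartialCStarAction.CrossedProduct.induction with
    | hp => exact isClosed_le (by fun_prop) (by fun_prop)
    | h f =>
      rw [hΦ, PartialCStarAction.CrossedProduct.norm_of, PartialCStarAction.CrossedProduct.norm_of]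
      -- The estimate is applied with constant `1`; the `C` used to construct `Φ` may be larger.
      simpa using hφ.norm_mapCc_le φ zero_le_one (by simpa using h) f
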